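/- Let $(B(t))_{t\in[0,\infty)}$ be a family of real-valued random variables on a measurable space $(\Omega,\mathcal A)$, and let $(\mathbb P_H)_{H\in(0,1]}$ be a family of probability measures on it such that, for every $H\in(0,1]$, the process $(B(t))_{t\ge 0}$ is under $\mathbb P_H$ a standard fractional Brownian motion with Hurst parameter $H$, that is, a mean-zero Gaussian process with $\operatorname{Cov}_H(B(t),B(s))=\tfrac12\big(t^{2H}+s^{2H}-|t-s|^{2H}\big)$ for all $s,t\ge 0$ (so $\operatorname{Var}_H(B(1))=1$). For $k\in\{0,1,2,\dots\}$ put $X_k=B(k)$ and $$C_k=\mathbf 1_{\{X_k\ge X_{k+1}<X_{k+2}\}}+\mathbf 1_{\{X_k<X_{k+1}\ge X_{k+2}\}},$$ and for $n\ge 1$ let $\hat c_n=\frac1n\sum_{k=0}^{n-1}C_k$ be the sample relative frequency of changes. For $H\in(0,\tfrac34)$ let $f_n(H)=n\cdot\operatorname{Var}_H(\hat c_n)$, where $\operatorname{Var}_H$ is the variance with respect to $\mathbb P_H$. Then the limit $f_\infty(H)=\lim_{n\to\infty}f_n(H)$ exists in $\mathbb R$ for every $H\in(0,\tfrac34)$,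 $f_n$ converges to $f_\infty$ uniformly on every compact subset $I\subset(0,\tfrac34)$, and $f_\infty$ is continuous and strictly positive on $(0,\tfrac34)$. -/

import Mathlib

open MeasureTheory ProbabilityTheory Filter Topology
open scoped NNReal

noncomputable section

/-- Under the measure `P`, the process `(B t)`, `t ∈ [0, ∞)`, is fractional Brownian motion with
Hurst parameter `H`: `H ∈ (0, 1]` and `B` is a mean-zero Gaussian process with covariance function
`Cov (B t, B s) = (t ^ (2H) + s ^ (2H) - |t - s| ^ (2H)) / 2 * Var (B 1)`.
(`IsGaussianProcess` implies that `P` is a probability measure.) -/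
structure IsFBM {Ω : Type*} [MeasurableSpace Ω] (H : ℝ) (B : ℝ≥0 → Ω → ℝ) (P : Measure Ω) :
    Prop where
  hurst_mem : H ∈ Set.Ioc (0 : ℝ) 1
  gaussian : IsGaussianProcess B P
  mean_zero : ∀ t, ∫ ω, B t ω ∂P = 0
  covariance : ∀ t s : ℝ≥0, cov[B t, B s; P] =
    1 / 2 * ((t : ℝ) ^ (2 * H) + (s : ℝ) ^ (2 * H) - |(t : ℝ) - (s : ℝ)| ^ (2 * H)) * Var[B 1; P]

/-- The equidistant discretization `X k = B k`, `k = 0, 1, 2, …`, of a process on `[0, ∞)`. -/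
def discretization {Ω : Type*} (B : ℝ≥0 → Ω → ℝ) (k : ℕ) (ω : Ω) : ℝ := B (k : ℝ≥0) ω

/-- The indicator `C k` for a change between up and down at time `k`. -/
def changeIndicator {Ω : Type*} (X : ℕ → Ω → ℝ) (k : ℕ) (ω : Ω) : ℝ :=
  Set.indicator {ω | X k ω ≥ X (k + 1) ω ∧ X (k + 1) ω < X (k + 2) ω} (fun _ => (1 : ℝ)) ω +
  Set.indicator {ω | X k ω < X (k + 1) ω ∧ X (k + 1) ω ≥ X (k + 2) ω} (fun _ => (1 : ℝ)) ω

/-- The sample relative frequency of changes `(C 0 + ⋯ + C (n - 1)) / n`. -/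
def changeFrequency {Ω : Type*} (X : ℕ → Ω → ℝ) (n : ℕ) (ω : Ω) : ℝ :=
  1 / (n : ℝ) * ∑ k ∈ Finset.range n, changeIndicator X k ω

/-- `n` times the variance, under `P H`, of the sample relative frequency of changes of the
equidistant discretization of `B`. -/
def scaledVariance {Ω : Type*} [MeasurableSpace Ω] (P : ℝ → Measure Ω) (B : ℝ≥0 → Ω → ℝ)
    (n : ℕ) (H : ℝ) : ℝ :=
  (n : ℝ) * Var[changeFrequency (discretization B) n; P H]

end

/-!
The increments `Y k = B (k + 1) - B k` form a centred stationary Gaussian sequence of variance one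
with autocovariances `fgnCov H k = O(k ^ (2 * H - 2))`. Since ties have probability zero, the number
of changes up to time `n` is almost surely the number of sign changes of `Y`
(`changeIndicator_ae_eq_signChange`), and the scaled variance of the frequency of changes is
`n⁻¹ * ∑ j < n, ∑ l < n, γ (l - j)`, where `γ` is the autocovariance function of the sign-change
indicators. Hence everything but positivity follows, with limit `∑ k, γ k`, from a summable bound
for `γ` that is locally uniform in `H`, and from the continuity of each `γ k` in `H`.

*Decay.* A sign change of `(Y k, Y (k + 1))` is the event that the normalized sum and difference of
the two variables, a planar standard Gaussian vector, lie in a cone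
(`IsStationaryGaussian.signChange_eq_indicator_cone`). The indicator of the cone is even, so it has
no linear part, and for bounded even functionals of two Gaussian vectors with cross-covariances of
size `ε` the covariance is `O(ε ^ 2)` (`abs_covariance_le_of_even`). No expansion is needed for
this: after Gaussian regression, conditioning on the first vector translates the second one by a
vector of size `ε`, and a second difference of the translation average of a bounded function is of
second order by the Cameron–Martin formula (`abs_integral_gaussianReal_second_difference_le`). So
`γ k` is bounded by the squares of the autocovariances at the lags `k - 1`, `k`, `k + 1`, of order
`k ^ (4 * H - 4)`, which is summable exactly because `H < 3 / 4`. Cesàro means of the partial sums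
then converge, uniformly under a common summable bound.

*Continuity.* The autocovariances are continuous in `H`, so the Gaussian vectors
`(Y 0, Y 1, Y k, Y (k + 1))` depend weakly continuously on `H`, and sign events are continuity sets
of nondegenerate Gaussian laws (`tendsto_measureReal_of_tendsto_covariance`).

*Positivity.* Let `z k` be the difference of the squares of the normalized difference and sum. It is
parallel to the quadratic component of the sign-change indicator, so that both the covariances of
the indicators with `z` and those of `z` with itself are positive multiples of one explicit
quadratic form `lagForm` in the autocovariances `ρ`. If the sum `e` of this form over all lags is
positive, then the nonnegativity of the asymptotic variance of the number of changes plus `t` times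
the sum of the `z k`, for small negative `t`, makes the asymptotic variance of the number of changes
positive (`IsStationaryGaussian.pos_of_tendsto_variance`). Summation by parts shows that `e` is a
multiple of the sum of the squares of `(ρ (k + 1) + ρ (k - 1)) / 2 - ρ 1 * ρ k`. It cannot vanish:
a solution of the resulting linear recurrence has a positive first integral, which is incompatible
with square-summability (`tsum_lagForm_pos`).
-/

/-! ### Gaussian vectors -/

section GaussianVectors

variable {Ω Ω' : Type*} [MeasurableSpace Ω] [MeasurableSpace Ω'] {P : Measure Ω} {Q : Measure Ω'}
  {ι κ : Type*} [Fintype ι] [Fintype κ]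

/-- A finite-dimensional Gaussian law is determined by its means and covariances. -/
lemma map_eq_of_mean_of_covariance {X : ι → Ω → ℝ} {Y : ι → Ω' → ℝ}
    (hX : HasGaussianLaw (fun ω i ↦ X i ω) P) (hY : HasGaussianLaw (fun ω i ↦ Y i ω) Q)
    (hm : ∀ i, ∫ ω, X i ω ∂P = ∫ ω, Y i ω ∂Q)
    (hc : ∀ i j, cov[X i, X j; P] = cov[Y i, Y j; Q]) :
    P.map (fun ω i ↦ X i ω) = Q.map (fun ω i ↦ Y i ω) := by
  classical
  have := hX.isProbabilityMeasure
  have := hY.isProbabilityMeasure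
  have hXi i : HasGaussianLaw (X i) P := hX.eval i
  have hYi i : HasGaussianLaw (Y i) Q := hY.eval i
  have := hX.isGaussian_map
  have := hY.isGaussian_map
  apply Measure.ext_of_charFunDual
  ext L
  obtain ⟨c, hL⟩ : ∃ c : ι → ℝ, ∀ x : ι → ℝ, L x = ∑ i, c i * x i := by
    refine ⟨fun i ↦ L (Pi.single i 1), fun x ↦ ?_⟩
    conv_lhs => rw [← Finset.univ_sum_single x]
    rw [map_sum]
    refine Finset.sum_congr rfl fun i _ ↦ ?_
    rw [mul_comm, ← smul_eq_mul, ← map_smul, ← Pi.single_smul, smul_eq_mul, mul_one]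
  rw [hX.charFunDual_map_eq_fun, hY.charFunDual_map_eq_fun]
  simp_rw [hL]
  have e1 : ∫ ω, ∑ i, c i * X i ω ∂P = ∫ ω, ∑ i, c i * Y i ω ∂Q := by
    rw [integral_finsetSum _ fun i _ ↦ (hXi i).integrable.const_mul _,
      integral_finsetSum _ fun i _ ↦ (hYi i).integrable.const_mul _]
    simp_rw [integral_const_mul, hm]
  have e2 : Var[fun ω ↦ ∑ i, c i * X i ω; P] =
      Var[fun ω ↦ ∑ i, c i * Y i ω; Q] := by
    have a1 : AEMeasurable (fun ω ↦ ∑ i, c i * X i ω) P :=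
      Finset.aemeasurable_fun_sum _ fun i _ ↦ (hXi i).aemeasurable.const_mul _
    have a2 : AEMeasurable (fun ω ↦ ∑ i, c i * Y i ω) Q :=
      Finset.aemeasurable_fun_sum _ fun i _ ↦ (hYi i).aemeasurable.const_mul _
    rw [← covariance_self a1, ← covariance_self a2,
      covariance_fun_sum_fun_sum (fun i ↦ (hXi i).memLp_two.const_mul _)
        (fun i ↦ (hXi i).memLp_two.const_mul _),
      covariance_fun_sum_fun_sum (fun i ↦ (hYi i).memLp_two.const_mul _)
        (fun i ↦ (hYi i).memLp_two.const_mul _)]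
    simp_rw [covariance_const_mul_left, covariance_const_mul_right, hc]
  rw [e1, e2]

/-- A centred Gaussian vector is symmetric. -/
lemma map_neg_eq_of_mean_zero {X : ι → Ω → ℝ} (hX : HasGaussianLaw (fun ω i ↦ X i ω) P)
    (hm : ∀ i, ∫ ω, X i ω ∂P = 0) :
    P.map (fun ω i ↦ -X i ω) = P.map (fun ω i ↦ X i ω) := by
  refine map_eq_of_mean_of_covariance (X := fun i ω ↦ -X i ω) ?_ hX ?_ ?_
  · exact hX.fun_neg
  · intro i; simp [integral_neg, hm]
  · intro i j; simp

/-- **Gaussian regression.** If `X` is an orthonormal family, jointly Gaussian with `W`, then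
subtracting from `W` its orthogonal projection onto the span of `X` leaves a remainder independent
of `X`. -/
lemma indepFun_residual {X : ι → Ω → ℝ} {W : κ → Ω → ℝ}
    (h : HasGaussianLaw (fun ω ↦ ((fun i ↦ X i ω), (fun j ↦ W j ω))) P)
    (hX : ∀ i i', i ≠ i' → cov[X i, X i'; P] = 0) (hX1 : ∀ i, cov[X i, X i; P] = 1) :
    IndepFun (fun ω i ↦ X i ω) (fun ω j ↦ W j ω - ∑ i, cov[X i, W j; P] * X i ω) P ∧
    HasGaussianLaw (fun ω ↦ ((fun i ↦ X i ω),
      (fun j ↦ W j ω - ∑ i, cov[X i, W j; P] * X i ω))) P := by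
  classical
  have := h.isProbabilityMeasure
  have hXi i : HasGaussianLaw (X i) P := h.fst.eval i
  have hWj j : HasGaussianLaw (W j) P := h.snd.eval j
  let L : ((ι → ℝ) × (κ → ℝ)) →L[ℝ] ((ι → ℝ) × (κ → ℝ)) :=
    (ContinuousLinearMap.fst ℝ _ _).prod (ContinuousLinearMap.snd ℝ _ _ -
      ContinuousLinearMap.pi fun j ↦ ∑ i, cov[X i, W j; P] •
        ((ContinuousLinearMap.proj i).comp (ContinuousLinearMap.fst ℝ (ι → ℝ) (κ → ℝ))))
  have hL := h.map_fun L
  have hL' : HasGaussianLaw (fun ω ↦ ((fun i ↦ X i ω),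
      (fun j ↦ W j ω - ∑ i, cov[X i, W j; P] * X i ω))) P := by
    convert! hL using 2 with ω
    simp only [L, ContinuousLinearMap.prod_apply, ContinuousLinearMap.coe_fst', Prod.mk.injEq,
      true_and]
    ext j
    simp
  refine ⟨hL'.indepFun_of_covariance_eval
    (Y := fun j ω ↦ W j ω - ∑ i, cov[X i, W j; P] * X i ω) ?_, hL'⟩
  intro i j
  rw [covariance_fun_sub_right (hXi i).memLp_two (hWj j).memLp_two
    (memLp_finsetSum _ fun i' _ ↦ (hXi i').memLp_two.const_mul _),
    covariance_fun_sum_right (fun i' ↦ (hXi i').memLp_two.const_mul _) (hXi i).memLp_two]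
  simp_rw [covariance_const_mul_right]
  rw [Finset.sum_eq_single i (fun i' _ hi' ↦ by rw [hX i i' hi'.symm, mul_zero])
    (fun hi ↦ absurd (Finset.mem_univ i) hi), hX1 i]
  simp

end GaussianVectors

/-! ### Second differences of Gaussian averages -/

section SecondDifference

/-- The Cameron–Martin formula on the line: translating the standard Gaussian. -/
lemma integral_gaussianReal_comp_add {F : ℝ → ℝ} (a : ℝ) :
    ∫ x, F (x + a) ∂(gaussianReal 0 1) =
      ∫ x, Real.exp (a * x - a ^ 2 / 2) * F x ∂(gaussianReal 0 1) := by
  have h1 : ∫ x, F (x + a) ∂(gaussianReal 0 1) = ∫ x, F x ∂(gaussianReal a 1) := by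
    have h := (Homeomorph.addRight a).measurableEmbedding.integral_map (μ := gaussianReal 0 1) F
    have h2 : (gaussianReal 0 1).map (Homeomorph.addRight a) = gaussianReal a 1 := by
      simpa using gaussianReal_map_add_const (μ := 0) (v := 1) a
    rw [h2] at h
    exact h.symm
  rw [h1, integral_gaussianReal_eq_integral_smul one_ne_zero,
    integral_gaussianReal_eq_integral_smul one_ne_zero]
  congr 1
  ext x
  have : Real.exp (-(x - a) ^ 2 / (2 * (1 : ℝ≥0))) =
      Real.exp (-(x - 0) ^ 2 / (2 * (1 : ℝ≥0))) * Real.exp (a * x - a ^ 2 / 2) := by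
    rw [← Real.exp_add]; congr 1; push_cast; ring
  simp only [smul_eq_mul, gaussianPDFReal, this]
  ring

lemma integrable_exp_mul_gaussianReal_std (a : ℝ) :
    Integrable (fun x ↦ Real.exp (a * x)) (gaussianReal 0 1) :=
  integrable_exp_mul_gaussianReal a

lemma integral_exp_mul_gaussianReal_std (a : ℝ) :
    ∫ x, Real.exp (a * x) ∂(gaussianReal 0 1) = Real.exp (a ^ 2 / 2) := by
  have := mgf_id_gaussianReal (μ := 0) (v := 1)
  have := congrFun this a
  simpa [mgf] using this

/-- Second differences of Gaussian averages of a bounded function are of the order of the squared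
step; no regularity of the function is needed. By the Cameron–Martin formula the translations turn
into a density `g`, whose `L ^ 2` norm is of second order. -/
lemma abs_integral_gaussianReal_second_difference_le {F : ℝ → ℝ} (hF : Measurable F)
    (hF1 : ∀ x, |F x| ≤ 1) (a : ℝ) :
    |∫ x, (F (x + a) + F (x - a) - 2 * F x) ∂(gaussianReal 0 1)| ≤ 4 * a ^ 2 := by
  have bdd {μ : Measure ℝ} [IsProbabilityMeasure μ] {f : ℝ → ℝ} (hf : Measurable f) (C : ℝ)
      (h : ∀ x, |f x| ≤ C) : Integrable f μ :=
    Integrable.of_bound hf.aestronglyMeasurable C (.of_forall h)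
  have hI : Integrable F (gaussianReal 0 1) := bdd hF 1 hF1
  have hIp : Integrable (fun x ↦ F (x + a)) (gaussianReal 0 1) :=
    bdd (by fun_prop) 1 fun x ↦ hF1 _
  have hIm : Integrable (fun x ↦ F (x - a)) (gaussianReal 0 1) :=
    bdd (by fun_prop) 1 fun x ↦ hF1 _
  rcases lt_or_ge 1 (a ^ 2) with ha | ha
  · -- for large steps the trivial bound is enough
    have : ∀ x, ‖F (x + a) + F (x - a) - 2 * F x‖ ≤ 4 := by
      intro x
      have h1 := abs_le.1 (hF1 (x + a)); have h2 := abs_le.1 (hF1 (x - a))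
      have h3 := abs_le.1 (hF1 x)
      rw [Real.norm_eq_abs, abs_le]; constructor <;> linarith [h1.1, h1.2]
    have := norm_integral_le_of_norm_le_const (μ := gaussianReal 0 1) (.of_forall this)
    simp only [Real.norm_eq_abs, probReal_univ, mul_one] at this
    linarith
  · set g : ℝ → ℝ := fun x ↦ Real.exp (-(a ^ 2 / 2)) * (Real.exp (a * x) + Real.exp (-a * x)) - 2
      with hg
    have hexp (b c : ℝ) : Integrable (fun x ↦ Real.exp (b * x) + Real.exp (c * x))
        (gaussianReal 0 1) :=
      (integrable_exp_mul_gaussianReal_std b).add (integrable_exp_mul_gaussianReal_std c)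
    have hg2 : ∀ x, g x ^ 2 = Real.exp (-a ^ 2) * (Real.exp (2 * a * x) + Real.exp (-2 * a * x))
        + (2 * Real.exp (-a ^ 2) + 4)
        - 4 * Real.exp (-(a ^ 2 / 2)) * (Real.exp (a * x) + Real.exp (-a * x)) := by
      intro x
      have e1 : Real.exp (-a ^ 2) = Real.exp (-(a ^ 2 / 2)) ^ 2 := by
        rw [← Real.exp_nat_mul]; congr 1; push_cast; ring
      have e2 : Real.exp (2 * a * x) = Real.exp (a * x) ^ 2 := by
        rw [← Real.exp_nat_mul]; congr 1; push_cast; ring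
      have e3 : Real.exp (-2 * a * x) = Real.exp (-a * x) ^ 2 := by
        rw [← Real.exp_nat_mul]; congr 1; push_cast; ring
      have e4 : Real.exp (a * x) * Real.exp (-a * x) = 1 := by
        rw [← Real.exp_add]; simp
      rw [hg, e1, e2, e3]
      linear_combination (2 * Real.exp (-(a ^ 2 / 2)) ^ 2) * e4
    have i2 : Integrable (fun x ↦ Real.exp (-a ^ 2) * (Real.exp (2 * a * x) +
        Real.exp (-2 * a * x)) + (2 * Real.exp (-a ^ 2) + 4)) (gaussianReal 0 1) :=
      ((hexp _ _).const_mul _).add (integrable_const _)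
    have i3 : Integrable (fun x ↦ 4 * Real.exp (-(a ^ 2 / 2)) * (Real.exp (a * x) +
        Real.exp (-a * x))) (gaussianReal 0 1) :=
      (hexp _ _).const_mul _
    have hg2I : Integrable (fun x ↦ g x ^ 2) (gaussianReal 0 1) := by
      simp_rw [hg2]; exact i2.sub i3
    have hg2v : ∫ x, g x ^ 2 ∂(gaussianReal 0 1) =
        2 * Real.exp (a ^ 2) + 2 * Real.exp (-a ^ 2) - 4 := by
      simp_rw [hg2]
      rw [integral_sub i2 i3, integral_add ((hexp _ _).const_mul _) (integrable_const _),
        integral_const_mul, integral_const_mul, integral_add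
          (integrable_exp_mul_gaussianReal_std _) (integrable_exp_mul_gaussianReal_std _),
        integral_add (integrable_exp_mul_gaussianReal_std _)
          (integrable_exp_mul_gaussianReal_std _)]
      simp_rw [integral_exp_mul_gaussianReal_std]
      have e1 : Real.exp (-a ^ 2) * Real.exp ((2 * a) ^ 2 / 2) = Real.exp (a ^ 2) := by
        rw [← Real.exp_add]; congr 1; ring
      have e2 : (-2 * a) ^ 2 = (2 * a) ^ 2 := by ring
      have e3 : Real.exp (-(a ^ 2 / 2)) * Real.exp (a ^ 2 / 2) = 1 := by
        rw [← Real.exp_add]; simp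
      rw [e2, neg_sq]
      simp only [integral_const, probReal_univ, smul_eq_mul, one_mul]
      linear_combination 2 * e1 - 8 * e3
    -- `cosh q - 1 ≤ q ^ 2` for `q ≤ 1`
    have hcosh : 2 * Real.exp (a ^ 2) + 2 * Real.exp (-a ^ 2) - 4 ≤ 4 * (a ^ 2) ^ 2 := by
      have h1 := abs_le.1 (Real.abs_exp_sub_one_sub_id_le (x := a ^ 2)
        (by rw [abs_of_nonneg (sq_nonneg a)]; exact ha))
      have h2 := abs_le.1 (Real.abs_exp_sub_one_sub_id_le (x := -a ^ 2)
        (by rw [abs_neg, abs_of_nonneg (sq_nonneg a)]; exact ha))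
      nlinarith [h1.2, h2.2]
    have key : ∫ x, (F (x + a) + F (x - a) - 2 * F x) ∂(gaussianReal 0 1) =
        ∫ x, g x * F x ∂(gaussianReal 0 1) := by
      have j1 : Integrable (fun x ↦ Real.exp (a * x - a ^ 2 / 2) * F x) (gaussianReal 0 1) := by
        refine Integrable.mul_bdd (c := 1) ?_ hF.aestronglyMeasurable (.of_forall hF1)
        simp_rw [sub_eq_add_neg, Real.exp_add]
        exact (integrable_exp_mul_gaussianReal_std _).mul_const _
      have j2 : Integrable (fun x ↦ Real.exp (-a * x - (-a) ^ 2 / 2) * F x)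
          (gaussianReal 0 1) := by
        refine Integrable.mul_bdd (c := 1) ?_ hF.aestronglyMeasurable (.of_forall hF1)
        simp_rw [sub_eq_add_neg, Real.exp_add]
        exact (integrable_exp_mul_gaussianReal_std _).mul_const _
      have c2 := integral_gaussianReal_comp_add (F := F) (-a)
      simp_rw [← sub_eq_add_neg (b := a)] at c2
      have i1 : Integrable (fun x ↦ F (x + a) + F (x - a)) (gaussianReal 0 1) := hIp.add hIm
      have j3 : Integrable (fun x ↦ Real.exp (a * x - a ^ 2 / 2) * F x +
        Real.exp (-a * x - (-a) ^ 2 / 2) * F x) (gaussianReal 0 1) := j1.add j2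
      rw [integral_sub i1 (hI.const_mul 2), integral_add hIp hIm,
        integral_gaussianReal_comp_add a, c2, ← integral_add j1 j2,
        ← integral_sub j3 (hI.const_mul 2)]
      congr 1
      ext x
      simp only [hg, sub_eq_add_neg, Real.exp_add, neg_sq]
      ring
    rw [key]
    rcases eq_or_ne a 0 with rfl | ha0
    · simp [hg]; norm_num
    have hapos : 0 < a ^ 2 := by positivity
    -- arithmetic-geometric mean: `|g| ≤ (g ^ 2 / a ^ 2 + a ^ 2) / 2`
    have hpt : ∀ x, ‖g x * F x‖ ≤ (g x ^ 2 / a ^ 2 + a ^ 2) / 2 := by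
      intro x
      rw [norm_mul, Real.norm_eq_abs, Real.norm_eq_abs]
      have : |g x| * |F x| ≤ |g x| := mul_le_of_le_one_right (abs_nonneg _) (hF1 x)
      refine this.trans ?_
      rw [← sq_abs (g x), div_add' _ _ _ hapos.ne', div_div, le_div_iff₀ (by positivity)]
      nlinarith [sq_nonneg (|g x| - a ^ 2)]
    have hb := norm_integral_le_of_norm_le (((hg2I.div_const (a ^ 2)).add
      (integrable_const (a ^ 2))).div_const 2) (.of_forall hpt)
    refine hb.trans ?_
    simp only [Pi.add_apply]
    rw [integral_div, integral_add (hg2I.div_const _) (integrable_const _), integral_div, hg2v]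
    simp only [integral_const, probReal_univ, smul_eq_mul, one_mul]
    have : (2 * Real.exp (a ^ 2) + 2 * Real.exp (-a ^ 2) - 4) / a ^ 2 ≤ 4 * a ^ 2 := by
      rw [div_le_iff₀ hapos]; nlinarith
    linarith

end SecondDifference

/-! ### Decorrelation of even functionals of Gaussian vectors -/

section Decorrelation

variable {Ω : Type*} [MeasurableSpace Ω] {P : Measure Ω}
  {ι κ : Type*} [Fintype ι] [Fintype κ]

lemma integral_comp_prodMk_of_indepFun {α β : Type*} [MeasurableSpace α] [MeasurableSpace β]
    [IsProbabilityMeasure P] {X : Ω → α} {Y : Ω → β} (hX : AEMeasurable X P)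
    (hY : AEMeasurable Y P) (h : IndepFun X Y P) {f : α × β → ℝ} (hf : Measurable f)
    (hi : Integrable f ((P.map X).prod (P.map Y))) :
    ∫ ω, f (X ω, Y ω) ∂P = ∫ x, ∫ ω, f (x, Y ω) ∂P ∂(P.map X) := by
  rw [← integral_map (φ := fun ω ↦ (X ω, Y ω)) (hX.prodMk hY) hf.aestronglyMeasurable,
    (indepFun_iff_map_prod_eq_prod_map_map hX hY).1 h, integral_prod _ hi]
  congr 1
  ext x
  exact integral_map hY (hf.comp measurable_prodMk_left).aestronglyMeasurable

lemma integrable_of_abs_le {α : Type*} [MeasurableSpace α] {μ : Measure α}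
    [IsFiniteMeasure μ] {f : α → ℝ} (hf : AEMeasurable f μ) {C : ℝ} (h : ∀ x, |f x| ≤ C) :
    Integrable f μ :=
  Integrable.of_bound hf.aestronglyMeasurable C (.of_forall h)

lemma memLp_two_of_abs_le {α : Type*} [MeasurableSpace α] {μ : Measure α}
    [IsFiniteMeasure μ] {f : α → ℝ} (hf : AEMeasurable f μ) {C : ℝ} (h : ∀ x, |f x| ≤ C) :
    MemLp f 2 μ :=
  MemLp.of_bound hf.aestronglyMeasurable C (.of_forall h)

/-- Translating a Gaussian vector `ξ` by `±m`, where `m` is the vector of covariances of `ξ` with a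
linear functional `⟨θ, ξ⟩`, has a second-order effect of the size of the variance of this
functional. The vector `ξ` splits into a multiple of `m` by the functional and an independent
remainder, so that this is a statement about translations of a real Gaussian. -/
lemma abs_integral_second_difference_le {ξ : ι → Ω → ℝ}
    (hξ : HasGaussianLaw (fun ω i ↦ ξ i ω) P) (hm0 : ∀ i, ∫ ω, ξ i ω ∂P = 0)
    (θ m : ι → ℝ) (hm : ∀ i, m i = ∑ j, θ j * cov[ξ j, ξ i; P])
    (hq : 0 < ∑ i, θ i * m i) {G : (ι → ℝ) → ℝ} (hG : Measurable G) (hG1 : ∀ x, |G x| ≤ 1) :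
    |∫ ω, (G (fun i ↦ ξ i ω + m i) + G (fun i ↦ ξ i ω - m i) - 2 * G (fun i ↦ ξ i ω)) ∂P|
      ≤ 4 * ∑ i, θ i * m i := by
  have := hξ.isProbabilityMeasure
  have hξi i : HasGaussianLaw (ξ i) P := hξ.eval i
  set q := ∑ i, θ i * m i with hqdef
  set s := √q with hs
  have hs0 : 0 < s := Real.sqrt_pos.2 hq
  have hsq : s ^ 2 = q := Real.sq_sqrt hq.le
  let Z : Ω → ℝ := fun ω ↦ ∑ j, θ j / s * ξ j ω
  have hcovZ i : cov[Z, ξ i; P] = m i / s := by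
    rw [covariance_fun_sum_left (fun j ↦ (hξi j).memLp_two.const_mul _) (hξi i).memLp_two]
    simp_rw [covariance_const_mul_left]
    rw [hm i, Finset.sum_div]
    exact Finset.sum_congr rfl fun j _ ↦ by ring
  have hjoint : HasGaussianLaw (fun ω ↦ ((fun _ : Unit ↦ Z ω), (fun i ↦ ξ i ω))) P := by
    let L : (ι → ℝ) →L[ℝ] ((Unit → ℝ) × (ι → ℝ)) :=
      (ContinuousLinearMap.pi fun _ ↦ ∑ j, (θ j / s) • ContinuousLinearMap.proj j).prod
        (ContinuousLinearMap.id ℝ _)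
    convert! hξ.map_fun L using 2 with ω
    simp only [L, ContinuousLinearMap.prod_apply, Prod.mk.injEq]
    refine ⟨?_, rfl⟩
    ext; simp [Z]
  have hZL : HasGaussianLaw Z P := hjoint.fst.eval (X := fun _ : Unit ↦ Z) ()
  have hZZ : cov[Z, Z; P] = 1 := by
    conv_lhs => rw [show cov[Z, Z; P] = cov[Z, fun ω ↦ ∑ j, θ j / s * ξ j ω; P] from rfl]
    rw [covariance_fun_sum_right (fun j ↦ (hξi j).memLp_two.const_mul _) hZL.memLp_two]
    simp_rw [covariance_const_mul_right, hcovZ]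
    rw [show ∑ i, θ i / s * (m i / s) = q / s ^ 2 by
      rw [hqdef, Finset.sum_div]; exact Finset.sum_congr rfl fun j _ ↦ by ring, hsq,
      div_self hq.ne']
  obtain ⟨hind, hres⟩ := indepFun_residual (X := fun _ : Unit ↦ Z) (W := ξ) hjoint
    (fun i j hij ↦ absurd rfl hij) (fun _ ↦ hZZ)
  simp only [Finset.univ_unique, Finset.sum_singleton, hcovZ] at hind hres
  set η : Ω → ι → ℝ := fun ω i ↦ ξ i ω - m i / s * Z ω with hη
  have hind' : IndepFun Z η P := hind.comp (measurable_pi_apply ()) measurable_id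
  have hηm : AEMeasurable η P := hres.snd.aemeasurable
  have hZmean : ∫ ω, Z ω ∂P = 0 := by
    rw [integral_finsetSum _ fun i _ ↦ (hξi i).integrable.const_mul _]
    simp [integral_const_mul, hm0]
  have hZlaw : P.map Z = gaussianReal 0 1 := by
    rw [hZL.map_eq_gaussianReal, hZmean, ← covariance_self hZL.aemeasurable, hZZ, Real.toNNReal_one]
  have hξη ω i : ξ i ω = m i / s * Z ω + η ω i := by simp [hη]
  let K : ℝ × (ι → ℝ) → ℝ := fun p ↦ G (fun i ↦ m i / s * p.1 + p.2 i)
  have hK : Measurable K := by fun_prop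
  let D : (ι → ℝ) × ℝ → ℝ := fun p ↦ K (p.2 + s, p.1) + K (p.2 - s, p.1) - 2 * K (p.2, p.1)
  have hD : Measurable D := by fun_prop
  have hDle p : |D p| ≤ 4 := by
    have h1 := abs_le.1 (hG1 (fun i ↦ m i / s * (p.2 + s) + p.1 i))
    have h2 := abs_le.1 (hG1 (fun i ↦ m i / s * (p.2 - s) + p.1 i))
    have h3 := abs_le.1 (hG1 (fun i ↦ m i / s * p.2 + p.1 i))
    simp only [D, K]
    rw [abs_le]; constructor <;> linarith [h1.1, h1.2]
  have e : ∀ ω, G (fun i ↦ ξ i ω + m i) + G (fun i ↦ ξ i ω - m i) - 2 * G (fun i ↦ ξ i ω) =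
      D (η ω, Z ω) := by
    intro ω
    simp only [D, K]
    congr 3
    · ext i; rw [hξη ω i]; field_simp; ring
    · ext i; rw [hξη ω i]; field_simp; ring
    · ext i; rw [hξη ω i]
  simp_rw [e]
  have : IsProbabilityMeasure (P.map η) := Measure.isProbabilityMeasure_map hηm
  have : IsProbabilityMeasure (P.map Z) := Measure.isProbabilityMeasure_map hZL.aemeasurable
  rw [integral_comp_prodMk_of_indepFun hηm hZL.aemeasurable hind'.symm hD
    (integrable_of_abs_le hD.aemeasurable hDle)]
  have hinner (y : ι → ℝ) : ‖∫ ω, D (y, Z ω) ∂P‖ ≤ 4 * q := by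
    rw [← integral_map (f := fun z ↦ D (y, z)) hZL.aemeasurable
      (hD.comp measurable_prodMk_left).aestronglyMeasurable, hZlaw, ← hsq]
    exact abs_integral_gaussianReal_second_difference_le (F := fun z ↦ K (z, y)) (by fun_prop)
      (fun z ↦ hG1 _) s
  have := norm_integral_le_of_norm_le_const (μ := P.map η) (.of_forall hinner)
  simpa using this

omit [Fintype κ] in
lemma covariance_residual_right {X : ι → Ω → ℝ} {W : κ → Ω → ℝ} [IsProbabilityMeasure P]
    (hX2 : ∀ i, MemLp (X i) 2 P) (hW2 : ∀ j, MemLp (W j) 2 P)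
    (hX : ∀ i i', i ≠ i' → cov[X i, X i'; P] = 0) (hX1 : ∀ i, cov[X i, X i; P] = 1) (j j' : κ) :
    cov[fun ω ↦ W j ω - ∑ i, cov[X i, W j; P] * X i ω,
      fun ω ↦ W j' ω - ∑ i, cov[X i, W j'; P] * X i ω; P] =
    cov[W j, W j'; P] - ∑ i, cov[X i, W j; P] * cov[X i, W j'; P] := by
  have hS (j : κ) : MemLp (fun ω ↦ ∑ i, cov[X i, W j; P] * X i ω) 2 P :=
    memLp_finsetSum _ fun i' _ ↦ (hX2 i').const_mul _
  rw [covariance_fun_sub_left (hW2 j) (hS j) (by exact (hW2 j').sub (hS j')),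
    covariance_fun_sub_right (hW2 j) (hW2 j') (hS j'),
    covariance_fun_sub_right (hS j) (hW2 j') (hS j'),
    covariance_fun_sum_right (fun i ↦ (hX2 i).const_mul _) (hW2 j),
    covariance_fun_sum_left (fun i ↦ (hX2 i).const_mul _) (hW2 j'),
    covariance_fun_sum_fun_sum (fun i ↦ (hX2 i).const_mul _) (fun i ↦ (hX2 i).const_mul _)]
  simp_rw [covariance_const_mul_left, covariance_const_mul_right]
  have : ∀ i, ∑ i', cov[X i, W j; P] * (cov[X i', W j'; P] * cov[X i, X i'; P]) =
      cov[X i, W j; P] * cov[X i, W j'; P] := by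
    intro i
    rw [Finset.sum_eq_single i (fun i' _ hi' ↦ by rw [hX i i' hi'.symm, mul_zero, mul_zero])
      (fun hi ↦ absurd (Finset.mem_univ i) hi), hX1 i, mul_one]
  simp_rw [this, covariance_comm (W j), mul_comm (cov[X _, W j'; P]) (cov[X _, W j; P])]
  ring

/-- Translating a centred planar Gaussian vector whose covariance matrix is close to the identity
changes the mean of a bounded even function by a term of second order. -/
lemma abs_integral_translate_sub_le {ξ : Fin 2 → Ω → ℝ}
    (hξG : HasGaussianLaw (fun ω j ↦ ξ j ω) P) (hξm : ∀ j, ∫ ω, ξ j ω ∂P = 0)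
    (ha1 : |cov[ξ 0, ξ 0; P] - 1| ≤ 2 / 100) (hc1 : |cov[ξ 1, ξ 1; P] - 1| ≤ 2 / 100)
    (hb1 : |cov[ξ 0, ξ 1; P]| ≤ 2 / 100)
    {G : (Fin 2 → ℝ) → ℝ} (hG : Measurable G) (hG1 : ∀ x, |G x| ≤ 1)
    (hGeven : ∀ x, G (fun i ↦ -x i) = G x) (m : Fin 2 → ℝ) :
    |∫ ω, G (fun j ↦ ξ j ω + m j) ∂P - ∫ ω, G (fun j ↦ ξ j ω) ∂P| ≤ 4 * (m 0 ^ 2 + m 1 ^ 2) := by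
  have := hξG.isProbabilityMeasure
  let φ : (Fin 2 → ℝ) → ℝ := fun m ↦ ∫ ω, G (fun j ↦ ξ j ω + m j) ∂P
  have hGintΩ {f : Ω → Fin 2 → ℝ} (hf : AEMeasurable f P) : Integrable (fun x ↦ G (f x)) P :=
    integrable_of_abs_le (hG.comp_aemeasurable hf) fun x ↦ hG1 _
  have hξadd (m : Fin 2 → ℝ) : AEMeasurable (fun ω j ↦ ξ j ω + m j) P :=
    hξG.aemeasurable.add_const m
  -- the translate average is even
  have hφeven m : φ (fun j ↦ -m j) = φ m := by
    have e1 : φ (fun j ↦ -m j) = ∫ ω, G (fun j ↦ -ξ j ω + m j) ∂P := by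
      simp only [φ]
      congr 1; ext ω
      rw [← hGeven]
      congr 1; ext j; ring
    have hneg : AEMeasurable (fun ω j ↦ -ξ j ω) P := hξG.aemeasurable.neg
    rw [e1, ← integral_map (f := fun y : Fin 2 → ℝ ↦ G (fun j ↦ y j + m j)) hneg
      (by exact (hG.comp (by fun_prop)).aestronglyMeasurable),
      map_neg_eq_of_mean_zero hξG hξm, integral_map hξG.aemeasurable
      (by exact (hG.comp (by fun_prop)).aestronglyMeasurable)]
  have e3 : ∫ ω, G (fun i ↦ ξ i ω) ∂P = φ 0 := by simp [φ]
  rw [e3]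
  change |φ m - φ 0| ≤ _
  by_cases hm : m = 0
  · simp [hm]
  set a := cov[ξ 0, ξ 0; P] with ha
  set b := cov[ξ 0, ξ 1; P] with hb
  set c := cov[ξ 1, ξ 1; P] with hc
  have hb' : cov[ξ 1, ξ 0; P] = b := covariance_comm _ _
  rw [abs_le] at ha1 hb1 hc1
  have hdet : 9 / 10 ≤ a * c - b ^ 2 := by nlinarith
  have hdet0 : 0 < a * c - b ^ 2 := by linarith
  -- the inverse covariance matrix applied to `m`
  let θ : Fin 2 → ℝ := ![(c * m 0 - b * m 1) / (a * c - b ^ 2),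
    (a * m 1 - b * m 0) / (a * c - b ^ 2)]
  have hθm i : m i = ∑ j, θ j * cov[ξ j, ξ i; P] := by
    rw [Fin.sum_univ_two]
    fin_cases i
    · change m 0 = (c * m 0 - b * m 1) / (a * c - b ^ 2) * a +
        (a * m 1 - b * m 0) / (a * c - b ^ 2) * cov[ξ 1, ξ 0; P]
      rw [hb', div_mul_eq_mul_div, div_mul_eq_mul_div, ← add_div, eq_div_iff hdet0.ne']; ring
    · change m 1 = (c * m 0 - b * m 1) / (a * c - b ^ 2) * b +
        (a * m 1 - b * m 0) / (a * c - b ^ 2) * c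
      rw [div_mul_eq_mul_div, div_mul_eq_mul_div, ← add_div, eq_div_iff hdet0.ne']; ring
  have hq : ∑ i, θ i * m i =
      (c * m 0 ^ 2 - 2 * b * (m 0 * m 1) + a * m 1 ^ 2) / (a * c - b ^ 2) := by
    rw [Fin.sum_univ_two]
    change (c * m 0 - b * m 1) / (a * c - b ^ 2) * m 0 +
        (a * m 1 - b * m 0) / (a * c - b ^ 2) * m 1 = _
    ring
  have hmpos : 0 < m 0 ^ 2 + m 1 ^ 2 := by
    by_contra hcon
    apply hm
    have h0 : m 0 = 0 := by nlinarith [sq_nonneg (m 0), sq_nonneg (m 1)]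
    have h1 : m 1 = 0 := by nlinarith [sq_nonneg (m 0), sq_nonneg (m 1)]
    ext i; fin_cases i <;> simp [h0, h1]
  have hcross : |b * (m 0 * m 1)| ≤ 2 / 100 * (m 0 ^ 2 + m 1 ^ 2) := by
    rw [abs_mul]
    have : |m 0 * m 1| ≤ m 0 ^ 2 + m 1 ^ 2 := by
      rw [abs_le]; constructor <;> nlinarith [sq_nonneg (m 0 + m 1), sq_nonneg (m 0 - m 1)]
    exact mul_le_mul (abs_le.2 hb1) this (abs_nonneg _) (by norm_num)
  rw [abs_le] at hcross
  have hc0 : 98 / 100 * m 0 ^ 2 ≤ c * m 0 ^ 2 ∧ c * m 0 ^ 2 ≤ 102 / 100 * m 0 ^ 2 :=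
    ⟨by nlinarith [sq_nonneg (m 0)], by nlinarith [sq_nonneg (m 0)]⟩
  have ha0 : 98 / 100 * m 1 ^ 2 ≤ a * m 1 ^ 2 ∧ a * m 1 ^ 2 ≤ 102 / 100 * m 1 ^ 2 :=
    ⟨by nlinarith [sq_nonneg (m 1)], by nlinarith [sq_nonneg (m 1)]⟩
  have hqpos : 0 < ∑ i, θ i * m i := by
    rw [hq]; apply div_pos _ hdet0; nlinarith
  have hqle : ∑ i, θ i * m i ≤ 2 * (m 0 ^ 2 + m 1 ^ 2) := by
    rw [hq, div_le_iff₀ hdet0]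
    nlinarith
  have hmain := abs_integral_second_difference_le hξG hξm θ m hθm hqpos hG hG1
  have hsub : (fun ω ↦ G fun i ↦ ξ i ω - m i) = fun ω ↦ G fun i ↦ ξ i ω + -m i := by
    ext ω; simp [sub_eq_add_neg]
  have i1 : Integrable (fun ω ↦ G fun i ↦ ξ i ω + m i) P := hGintΩ (hξadd m)
  have i2 : Integrable (fun ω ↦ G fun i ↦ ξ i ω - m i) P := by
    rw [hsub]; exact hGintΩ (hξadd fun i ↦ -m i)
  have i12 : Integrable (fun ω ↦ (G fun i ↦ ξ i ω + m i) + G fun i ↦ ξ i ω - m i) P := i1.add i2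
  have i3 : Integrable (fun ω ↦ 2 * G fun i ↦ ξ i ω) P :=
    (hGintΩ hξG.aemeasurable).const_mul 2
  rw [integral_sub i12 i3, integral_add i1 i2, integral_const_mul, hsub] at hmain
  have e2 : ∫ ω, G (fun i ↦ ξ i ω + -m i) ∂P = φ m := hφeven m
  have e1 : ∫ ω, G (fun i ↦ ξ i ω + m i) ∂P = φ m := rfl
  rw [e1, e2, e3] at hmain
  rw [show φ m + φ m - 2 * φ 0 = 2 * (φ m - φ 0) by ring, abs_mul, abs_two] at hmain
  linarith

/-- **Decorrelation of even functionals.** If the cross-covariances of two planar standard Gaussian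
vectors are at most `ε`, then the covariance of bounded functionals of them, one of which is even,
is of order `ε ^ 2`. Evenness kills the term of first order. -/
lemma abs_covariance_le_of_even {X W : Fin 2 → Ω → ℝ}
    (h : HasGaussianLaw (fun ω ↦ ((fun i ↦ X i ω), (fun j ↦ W j ω))) P)
    (hXm : ∀ i, ∫ ω, X i ω ∂P = 0) (hWm : ∀ i, ∫ ω, W i ω ∂P = 0)
    (hX : ∀ i i', i ≠ i' → cov[X i, X i'; P] = 0) (hX1 : ∀ i, cov[X i, X i; P] = 1)
    (hW : ∀ i i', i ≠ i' → cov[W i, W i'; P] = 0) (hW1 : ∀ i, cov[W i, W i; P] = 1)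
    {ε : ℝ} (hε : ε ≤ 1 / 10) (hXW : ∀ i j, |cov[X i, W j; P]| ≤ ε)
    {F G : (Fin 2 → ℝ) → ℝ} (hF : Measurable F) (hF1 : ∀ x, |F x| ≤ 1)
    (hG : Measurable G) (hG1 : ∀ x, |G x| ≤ 1) (hGeven : ∀ x, G (fun i ↦ -x i) = G x) :
    |cov[fun ω ↦ F (fun i ↦ X i ω), fun ω ↦ G (fun i ↦ W i ω); P]| ≤ 64 * ε ^ 2 := by
  have := h.isProbabilityMeasure
  have hXi i : HasGaussianLaw (X i) P := h.fst.eval i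
  have hWi i : HasGaussianLaw (W i) P := h.snd.eval i
  have hε0 : 0 ≤ ε := (abs_nonneg _).trans (hXW 0 0)
  obtain ⟨hind, hres⟩ := indepFun_residual h hX hX1
  set R : Fin 2 → Fin 2 → ℝ := fun i j ↦ cov[X i, W j; P] with hR
  set ξ : Fin 2 → Ω → ℝ := fun j ω ↦ W j ω - ∑ i, R i j * X i ω with hξ
  have hξG : HasGaussianLaw (fun ω j ↦ ξ j ω) P := hres.snd
  have hξm j : ∫ ω, ξ j ω ∂P = 0 := by
    rw [hξ, integral_sub (hWi j).integrable
      (integrable_finsetSum _ fun i _ ↦ (hXi i).integrable.const_mul _),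
      integral_finsetSum _ fun i _ ↦ (hXi i).integrable.const_mul _]
    simp [integral_const_mul, hXm, hWm]
  have hξcov j j' : cov[ξ j, ξ j'; P] = cov[W j, W j'; P] - ∑ i, R i j * R i j' :=
    covariance_residual_right (fun i ↦ (hXi i).memLp_two) (fun i ↦ (hWi i).memLp_two) hX hX1 j j'
  have hRle i j : |R i j| ≤ ε := hXW i j
  have hRR i j i' j' : |R i j * R i' j'| ≤ 1 / 100 := by
    rw [abs_mul]
    nlinarith [hRle i j, hRle i' j', abs_nonneg (R i j), abs_nonneg (R i' j')]
  let φ : (Fin 2 → ℝ) → ℝ := fun m ↦ ∫ ω, G (fun j ↦ ξ j ω + m j) ∂P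
  have hφle m : |φ m - φ 0| ≤ 4 * (m 0 ^ 2 + m 1 ^ 2) := by
    have e0 : φ 0 = ∫ ω, G (fun i ↦ ξ i ω) ∂P := by simp [φ]
    rw [e0]
    refine abs_integral_translate_sub_le hξG hξm ?_ ?_ ?_ hG hG1 hGeven m
    · rw [hξcov, hW1, Fin.sum_univ_two]
      have h1 := abs_le.1 (hRR 0 0 0 0); have h2 := abs_le.1 (hRR 1 0 1 0)
      rw [abs_le]; constructor <;> linarith [h1.1, h1.2, h2.1, h2.2]
    · rw [hξcov, hW1, Fin.sum_univ_two]
      have h1 := abs_le.1 (hRR 0 1 0 1); have h2 := abs_le.1 (hRR 1 1 1 1)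
      rw [abs_le]; constructor <;> linarith [h1.1, h1.2, h2.1, h2.2]
    · rw [hξcov, hW _ _ (by decide), Fin.sum_univ_two]
      have h1 := abs_le.1 (hRR 0 0 0 1); have h2 := abs_le.1 (hRR 1 0 1 1)
      rw [abs_le]; constructor <;> linarith [h1.1, h1.2, h2.1, h2.2]
  have hXm' : AEMeasurable (fun ω i ↦ X i ω) P := h.fst.aemeasurable
  have hWm' : AEMeasurable (fun ω i ↦ W i ω) P := h.snd.aemeasurable
  have hFX : AEMeasurable (fun ω ↦ F (fun i ↦ X i ω)) P := hF.comp_aemeasurable hXm'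
  have hGW : AEMeasurable (fun ω ↦ G (fun i ↦ W i ω)) P := hG.comp_aemeasurable hWm'
  have hFI : Integrable (fun ω ↦ F (fun i ↦ X i ω)) P := integrable_of_abs_le hFX fun _ ↦ hF1 _
  have hGI : Integrable (fun ω ↦ G (fun i ↦ W i ω)) P := integrable_of_abs_le hGW fun _ ↦ hG1 _
  have hFG : Integrable (fun ω ↦ F (fun i ↦ X i ω) * G (fun i ↦ W i ω)) P :=
    hFI.mul_bdd hGW.aestronglyMeasurable (.of_forall fun _ ↦ hG1 _)
  let M : (Fin 2 → ℝ) → Fin 2 → ℝ := fun x j ↦ ∑ i, R i j * x i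
  have hM : Measurable M := by fun_prop
  have hWξ ω : (fun j ↦ W j ω) = fun j ↦ ξ j ω + M (fun i ↦ X i ω) j := by
    ext j; simp [hξ, M]
  have hφ1 m : |φ m| ≤ 1 := by
    have := norm_integral_le_of_norm_le_const (μ := P) (f := fun ω ↦ G fun j ↦ ξ j ω + m j)
      (C := 1) (.of_forall fun ω ↦ hG1 _)
    simpa using this
  have hφmeas : Measurable φ := by
    have hφe : φ = fun m ↦ ∫ y, G (fun j ↦ y j + m j) ∂(P.map fun ω j ↦ ξ j ω) := by
      ext m
      rw [integral_map hξG.aemeasurable (by exact (hG.comp (by fun_prop)).aestronglyMeasurable)]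
    have : IsProbabilityMeasure (P.map fun ω j ↦ ξ j ω) :=
      Measure.isProbabilityMeasure_map hξG.aemeasurable
    rw [hφe]
    refine (StronglyMeasurable.integral_prod_right (ν := P.map fun ω j ↦ ξ j ω)
      (f := fun (m : Fin 2 → ℝ) (y : Fin 2 → ℝ) ↦ G (fun j ↦ y j + m j)) ?_).measurable
    apply Measurable.stronglyMeasurable
    change Measurable fun p : (Fin 2 → ℝ) × (Fin 2 → ℝ) ↦ G (fun j ↦ p.2 j + p.1 j)
    fun_prop
  -- conditioning on `X`
  have hcond {K : (Fin 2 → ℝ) → ℝ} (hK : Measurable K) (hK1 : ∀ x, |K x| ≤ 1) :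
      ∫ ω, K (fun i ↦ X i ω) * G (fun i ↦ W i ω) ∂P =
        ∫ ω, K (fun i ↦ X i ω) * φ (M fun i ↦ X i ω) ∂P := by
    let f : (Fin 2 → ℝ) × (Fin 2 → ℝ) → ℝ := fun p ↦ K p.1 * G (fun j ↦ p.2 j + M p.1 j)
    have hf : Measurable f := by fun_prop
    have hf1 p : |f p| ≤ 1 := by
      simp only [f, abs_mul]
      exact mul_le_one₀ (hK1 _) (abs_nonneg _) (hG1 _)
    have : IsProbabilityMeasure (P.map fun ω j ↦ ξ j ω) :=
      Measure.isProbabilityMeasure_map hξG.aemeasurable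
    have : IsProbabilityMeasure (P.map fun ω i ↦ X i ω) :=
      Measure.isProbabilityMeasure_map hXm'
    have e := integral_comp_prodMk_of_indepFun hXm' hξG.aemeasurable hind hf
      (integrable_of_abs_le hf.aemeasurable hf1)
    have e' : ∀ ω, f ((fun i ↦ X i ω), fun j ↦ ξ j ω) =
        K (fun i ↦ X i ω) * G (fun i ↦ W i ω) := by
      intro ω; simp only [f]; rw [hWξ ω]
    simp_rw [e'] at e
    rw [e]
    simp only [f, integral_const_mul]
    rw [integral_map (f := fun x ↦ K x * φ (M x)) hXm'
      (hK.mul (hφmeas.comp hM)).aestronglyMeasurable]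
  have hφX : AEMeasurable (fun ω ↦ φ (M fun i ↦ X i ω)) P :=
    (hφmeas.comp hM).comp_aemeasurable hXm'
  have hφI : Integrable (fun ω ↦ φ (M fun i ↦ X i ω)) P :=
    integrable_of_abs_le hφX fun _ ↦ hφ1 _
  have hXsq i : Integrable (fun ω ↦ X i ω ^ 2) P := (hXi i).memLp_two.integrable_sq
  have hXsq1 i : ∫ ω, X i ω ^ 2 ∂P = 1 := by
    rw [← hX1 i, covariance_self (hXi i).aemeasurable,
      variance_of_integral_eq_zero (hXi i).aemeasurable (hXm i)]
  have hbound ω : |φ (M fun i ↦ X i ω) - φ 0| ≤ 16 * ε ^ 2 * (X 0 ω ^ 2 + X 1 ω ^ 2) := by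
    refine (hφle _).trans ?_
    have hMj j : (M (fun i ↦ X i ω) j) ^ 2 ≤ 2 * ε ^ 2 * (X 0 ω ^ 2 + X 1 ω ^ 2) := by
      simp only [M, Fin.sum_univ_two]
      have h0 : R 0 j ^ 2 ≤ ε ^ 2 := sq_le_sq' (by linarith [(abs_le.1 (hRle 0 j)).1])
        (abs_le.1 (hRle 0 j)).2
      have h1 : R 1 j ^ 2 ≤ ε ^ 2 := sq_le_sq' (by linarith [(abs_le.1 (hRle 1 j)).1])
        (abs_le.1 (hRle 1 j)).2
      have h0' := mul_le_mul_of_nonneg_right h0 (sq_nonneg (X 0 ω))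
      have h1' := mul_le_mul_of_nonneg_right h1 (sq_nonneg (X 1 ω))
      nlinarith [sq_nonneg (R 0 j * X 0 ω - R 1 j * X 1 ω)]
    linarith [hMj 0, hMj 1]
  have hquad : Integrable (fun ω ↦ 16 * ε ^ 2 * (X 0 ω ^ 2 + X 1 ω ^ 2)) P :=
    ((hXsq 0).add (hXsq 1)).const_mul _
  have hquadv : ∫ ω, 16 * ε ^ 2 * (X 0 ω ^ 2 + X 1 ω ^ 2) ∂P = 32 * ε ^ 2 := by
    rw [integral_const_mul, integral_add (hXsq 0) (hXsq 1), hXsq1, hXsq1]; ring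
  have hA : |∫ ω, F (fun i ↦ X i ω) * (φ (M fun i ↦ X i ω) - φ 0) ∂P| ≤ 32 * ε ^ 2 := by
    rw [← hquadv]
    refine norm_integral_le_of_norm_le (f := fun ω ↦ F (fun i ↦ X i ω) *
      (φ (M fun i ↦ X i ω) - φ 0)) hquad (.of_forall fun ω ↦ ?_)
    rw [norm_mul, Real.norm_eq_abs, Real.norm_eq_abs]
    exact (mul_le_of_le_one_left (abs_nonneg _) (hF1 _)).trans (hbound ω)
  have hB : |∫ ω, (φ (M fun i ↦ X i ω) - φ 0) ∂P| ≤ 32 * ε ^ 2 := by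
    rw [← hquadv]
    exact norm_integral_le_of_norm_le (f := fun ω ↦ φ (M fun i ↦ X i ω) - φ 0) hquad
      (.of_forall hbound)
  have hEF : |∫ ω, F (fun i ↦ X i ω) ∂P| ≤ 1 := by
    have := norm_integral_le_of_norm_le_const (μ := P) (f := fun ω ↦ F fun j ↦ X j ω)
      (C := 1) (.of_forall fun ω ↦ hF1 _)
    simpa using this
  have hGone := hcond (K := fun _ ↦ 1) measurable_const (fun _ ↦ by simp)
  simp only [one_mul] at hGone
  have hFφ : Integrable (fun ω ↦ F (fun i ↦ X i ω) * φ (M fun i ↦ X i ω)) P :=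
    hFI.mul_bdd hφX.aestronglyMeasurable (.of_forall fun _ ↦ hφ1 _)
  have hcov : cov[fun ω ↦ F (fun i ↦ X i ω), fun ω ↦ G (fun i ↦ W i ω); P] =
      ∫ ω, F (fun i ↦ X i ω) * (φ (M fun i ↦ X i ω) - φ 0) ∂P -
      (∫ ω, F (fun i ↦ X i ω) ∂P) * ∫ ω, (φ (M fun i ↦ X i ω) - φ 0) ∂P := by
    rw [covariance_eq_sub (memLp_two_of_abs_le hFX fun _ ↦ hF1 _)
      (memLp_two_of_abs_le hGW fun _ ↦ hG1 _)]
    simp only [Pi.mul_apply]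
    rw [hcond hF hF1, hGone, integral_sub hφI (integrable_const _)]
    simp_rw [mul_sub]
    rw [integral_sub hFφ (hFI.mul_const _), integral_mul_const]
    simp only [integral_const, probReal_univ, smul_eq_mul, one_mul]
    ring
  rw [hcov]
  refine (abs_sub _ _).trans ?_
  rw [abs_mul]
  nlinarith [mul_le_mul hEF hB (abs_nonneg _) zero_le_one]

end Decorrelation

/-! ### Squares of Gaussian variables -/

section SquaresOfGaussians

variable {Ω : Type*} [MeasurableSpace Ω] {P : Measure Ω} {ι : Type*} [Fintype ι]

lemma memLp_two_sq_of_hasGaussianLaw {Z : Ω → ℝ} (hZ : HasGaussianLaw Z P) :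
    MemLp (fun ω ↦ Z ω ^ 2) 2 P := by
  have := hZ.isProbabilityMeasure
  rw [memLp_two_iff_integrable_sq (hZ.aemeasurable.pow_const 2).aestronglyMeasurable]
  have h := (hZ.memLp (p := 4) (by norm_num)).integrable_norm_pow (by norm_num)
  refine h.congr (.of_forall fun ω ↦ ?_)
  change ‖Z ω‖ ^ 4 = (Z ω ^ 2) ^ 2
  rw [Real.norm_eq_abs, show (4 : ℕ) = 2 * 2 from rfl, pow_mul, sq_abs]

/-- In the covariance of a functional of an orthonormal Gaussian family `X` with the square of a
jointly Gaussian variable, that variable can be replaced by its projection onto the span of `X`. -/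
lemma covariance_sq_eq_covariance_projection_sq {X : ι → Ω → ℝ} {W : Ω → ℝ}
    (h : HasGaussianLaw (fun ω ↦ ((fun i ↦ X i ω), W ω)) P)
    (hXm : ∀ i, ∫ ω, X i ω ∂P = 0) (hWm : ∫ ω, W ω ∂P = 0)
    (hX : ∀ i i', i ≠ i' → cov[X i, X i'; P] = 0) (hX1 : ∀ i, cov[X i, X i; P] = 1)
    {F : (ι → ℝ) → ℝ} (hF : Measurable F) (hF2 : MemLp (fun ω ↦ F (fun i ↦ X i ω)) 2 P) :
    cov[fun ω ↦ F (fun i ↦ X i ω), fun ω ↦ W ω ^ 2; P] =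
      cov[fun ω ↦ F (fun i ↦ X i ω), fun ω ↦ (∑ i, cov[X i, W; P] * X i ω) ^ 2; P] := by
  have := h.isProbabilityMeasure
  have hXi i : HasGaussianLaw (X i) P := h.fst.eval i
  have hW : HasGaussianLaw W P := h.snd
  have hjoint : HasGaussianLaw (fun ω ↦ ((fun i ↦ X i ω), (fun _ : Unit ↦ W ω))) P := by
    exact h.map_fun ((ContinuousLinearMap.fst ℝ (ι → ℝ) ℝ).prod
      (ContinuousLinearMap.pi fun _ : Unit ↦ ContinuousLinearMap.snd ℝ (ι → ℝ) ℝ))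
  obtain ⟨hind, hres⟩ := indepFun_residual (W := fun _ : Unit ↦ W) hjoint hX hX1
  set S : Ω → ℝ := fun ω ↦ ∑ i, cov[X i, W; P] * X i ω with hS
  set ξ : Ω → ℝ := fun ω ↦ W ω - S ω with hξ
  have hξG : HasGaussianLaw ξ P := hres.snd.eval (X := fun _ : Unit ↦ ξ) ()
  have hSG : HasGaussianLaw S P := by
    convert! h.fst.map_fun (∑ i, cov[X i, W; P] • ContinuousLinearMap.proj (R := ℝ)
      (φ := fun _ : ι ↦ ℝ) i) using 1
    ext ω; simp [hS]
  have hξ2 := memLp_two_sq_of_hasGaussianLaw hξG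
  have hS2 := memLp_two_sq_of_hasGaussianLaw hSG
  have hind' : IndepFun (fun ω i ↦ X i ω) ξ P :=
    hind.comp measurable_id (measurable_pi_apply ())
  have hξm : ∫ ω, ξ ω ∂P = 0 := by
    rw [hξ, integral_sub hW.integrable hSG.integrable, hWm, hS,
      integral_finsetSum _ fun i _ ↦ (hXi i).integrable.const_mul _]
    simp [integral_const_mul, hXm]
  have hSξ2 : MemLp (fun ω ↦ S ω * ξ ω) 2 P := by
    have := (((memLp_two_sq_of_hasGaussianLaw hW).sub hS2).sub hξ2).const_mul (1 / 2)
    refine this.ae_eq (.of_forall fun ω ↦ ?_)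
    simp only [hξ, Pi.sub_apply]
    ring
  have hdecomp : (fun ω ↦ W ω ^ 2) =
      (fun ω ↦ S ω ^ 2) + ((2 : ℝ) • (fun ω ↦ S ω * ξ ω) + fun ω ↦ ξ ω ^ 2) := by
    ext ω
    simp only [hξ, Pi.add_apply, Pi.smul_apply, smul_eq_mul]
    ring
  have hc1 : cov[fun ω ↦ F (fun i ↦ X i ω), fun ω ↦ ξ ω ^ 2; P] = 0 :=
    (hind'.comp hF (measurable_id.pow_const 2)).covariance_eq_zero hF2 hξ2
  have hSmeas : Measurable fun x : ι → ℝ ↦ ∑ i, cov[X i, W; P] * x i := by fun_prop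
  have hc2 : cov[fun ω ↦ F (fun i ↦ X i ω), fun ω ↦ S ω * ξ ω; P] = 0 := by
    rw [covariance_eq_sub hF2 hSξ2]
    have e1 : ∫ ω, S ω * ξ ω ∂P = 0 := by
      have hi : IndepFun S ξ P := hind'.comp hSmeas measurable_id
      rw [hi.integral_fun_mul_eq_mul_integral
        hSG.aemeasurable.aestronglyMeasurable hξG.aemeasurable.aestronglyMeasurable, hξm, mul_zero]
    have e2 : ∫ ω, (F (fun i ↦ X i ω) * S ω) * ξ ω ∂P = 0 := by
      have hi : IndepFun (fun ω ↦ F (fun i ↦ X i ω) * S ω) ξ P :=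
        hind'.comp (hF.mul hSmeas) measurable_id
      rw [hi.integral_fun_mul_eq_mul_integral
        (hF2.aestronglyMeasurable.mul hSG.aemeasurable.aestronglyMeasurable)
        hξG.aemeasurable.aestronglyMeasurable, hξm, mul_zero]
    simp_rw [mul_assoc] at e2
    simp only [Pi.mul_apply]
    rw [e1, e2]; ring
  rw [hdecomp, covariance_add_right hF2 hS2 ((hSξ2.const_smul (2 : ℝ)).add hξ2),
    covariance_add_right hF2 (hSξ2.const_smul (2 : ℝ)) hξ2, covariance_smul_right, hc1, hc2,
    mul_zero, add_zero, add_zero]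

/-- The covariance of the squares of two jointly Gaussian standard variables is proportional to the
square of their covariance. -/
lemma covariance_sq_sq {Z W : Ω → ℝ} (h : HasGaussianLaw (fun ω ↦ (Z ω, W ω)) P)
    (hZm : ∫ ω, Z ω ∂P = 0) (hWm : ∫ ω, W ω ∂P = 0) (hZ1 : cov[Z, Z; P] = 1) :
    cov[fun ω ↦ Z ω ^ 2, fun ω ↦ W ω ^ 2; P] =
      Var[fun x ↦ x ^ 2; gaussianReal 0 1] * cov[Z, W; P] ^ 2 := by
  have hZ : HasGaussianLaw Z P := h.fst
  have hjoint : HasGaussianLaw (fun ω ↦ ((fun _ : Unit ↦ Z ω), W ω)) P := by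
    exact h.map_fun ((ContinuousLinearMap.pi fun _ : Unit ↦ ContinuousLinearMap.fst ℝ ℝ ℝ).prod
      (ContinuousLinearMap.snd ℝ ℝ ℝ))
  have key := covariance_sq_eq_covariance_projection_sq (X := fun _ : Unit ↦ Z) hjoint
    (fun _ ↦ hZm) hWm (fun i j hij ↦ absurd rfl hij) (fun _ ↦ hZ1)
    (F := fun x ↦ x () ^ 2) (by fun_prop) (memLp_two_sq_of_hasGaussianLaw hZ)
  rw [key]
  simp only [Finset.univ_unique, Finset.sum_singleton, mul_pow]
  have hlaw : P.map Z = gaussianReal 0 1 := by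
    rw [hZ.map_eq_gaussianReal, hZm, ← covariance_self hZ.aemeasurable, hZ1, Real.toNNReal_one]
  rw [covariance_const_mul_right, covariance_self (hZ.aemeasurable.pow_const 2), ← hlaw,
    variance_map (by fun_prop) hZ.aemeasurable, mul_comm]
  rfl

end SquaresOfGaussians

/-! ### The quadratic component of the sign-change indicator -/

section QuadraticComponent

lemma hasDerivAt_mul_gaussianPDFReal (x : ℝ) :
    HasDerivAt (fun x ↦ -(x * gaussianPDFReal 0 1 x)) (gaussianPDFReal 0 1 x * (x ^ 2 - 1)) x := by
  have h : HasDerivAt (gaussianPDFReal 0 1) (gaussianPDFReal 0 1 x * (-x)) x := by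
    rw [gaussianPDFReal_def]
    have h1 : HasDerivAt (fun x : ℝ ↦ -(x - 0) ^ 2 / (2 * (1 : ℝ≥0))) (-x) x := by
      have h2 : HasDerivAt (fun x : ℝ ↦ -(1 / 2) * x ^ 2) (-(1 / 2) * (2 * x)) x := by
        have := (hasDerivAt_pow 2 x).const_mul (-(1 / 2))
        rwa [Nat.cast_ofNat, Nat.add_one_sub_one, pow_one] at this
      have h3 : (fun x : ℝ ↦ -(x - 0) ^ 2 / (2 * (1 : ℝ≥0))) = fun x ↦ -(1 / 2) * x ^ 2 := by
        ext x; push_cast; ring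
      rw [h3, show -x = -(1 / 2) * (2 * x) by ring]
      exact h2
    have h4 := (h1.exp).const_mul (√(2 * Real.pi * (1 : ℝ≥0)))⁻¹
    rw [← mul_assoc] at h4
    exact h4
  have h5 := ((hasDerivAt_id' x).mul h).neg
  rw [show gaussianPDFReal 0 1 x * (x ^ 2 - 1) =
    -(1 * gaussianPDFReal 0 1 x + x * (gaussianPDFReal 0 1 x * -x)) by ring]
  exact h5

lemma continuous_gaussianPDFReal_std : Continuous (gaussianPDFReal 0 1) := by
  rw [gaussianPDFReal_def]; fun_prop

lemma integral_indicator_gaussianReal_Icc {s : ℝ} (hs : 0 ≤ s) :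
    ∫ u, (Set.Icc (-s) s).indicator (fun u ↦ u ^ 2 - 1) u ∂(gaussianReal 0 1) =
      -(2 * s * gaussianPDFReal 0 1 s) := by
  rw [integral_gaussianReal_eq_integral_smul one_ne_zero]
  have : (fun x ↦ gaussianPDFReal 0 1 x • (Set.Icc (-s) s).indicator (fun u ↦ u ^ 2 - 1) x) =
      (Set.Icc (-s) s).indicator (fun x ↦ gaussianPDFReal 0 1 x * (x ^ 2 - 1)) := by
    ext x
    by_cases hx : x ∈ Set.Icc (-s) s <;> simp [hx]
  rw [this, integral_indicator measurableSet_Icc, integral_Icc_eq_integral_Ioc,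
    ← intervalIntegral.integral_of_le (by linarith),
    intervalIntegral.integral_eq_sub_of_hasDerivAt (fun x _ ↦ hasDerivAt_mul_gaussianPDFReal x)
      ((continuous_gaussianPDFReal_std.mul (by fun_prop)).intervalIntegrable _ _)]
  have : gaussianPDFReal 0 1 (-s) = gaussianPDFReal 0 1 s := by simp [gaussianPDFReal]
  rw [this]; ring

lemma integral_indicator_gaussianReal_Ioo {s : ℝ} (hs : 0 ≤ s) :
    ∫ u, (Set.Ioo (-s) s).indicator (fun u ↦ u ^ 2 - 1) u ∂(gaussianReal 0 1) =
      -(2 * s * gaussianPDFReal 0 1 s) := by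
  rw [← integral_indicator_gaussianReal_Icc hs]
  have := nullSingletonClass_gaussianReal (μ := 0) (v := 1) one_ne_zero
  rw [integral_indicator measurableSet_Icc, integral_indicator measurableSet_Ioo,
    integral_Icc_eq_integral_Ioo]

lemma integral_abs_mul_exp_neg_mul_sq {b : ℝ} (hb : 0 < b) :
    ∫ x : ℝ, |x| * Real.exp (-b * x ^ 2) = 1 / b := by
  have h1 := integral_comp_abs (f := fun x ↦ x * Real.exp (-b * x ^ 2))
  simp only [sq_abs] at h1
  rw [h1]
  have h2 := integral_mul_cexp_neg_mul_sq (b := (b : ℂ)) (by simpa using hb)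
  have h3 : ∫ r in Set.Ioi (0 : ℝ), (r : ℂ) * Complex.exp (-(b : ℂ) * (r : ℂ) ^ 2) =
      ((∫ r in Set.Ioi (0 : ℝ), r * Real.exp (-b * r ^ 2) : ℝ) : ℂ) := by
    rw [← integral_complex_ofReal]
    congr 1; ext r; push_cast; rfl
  rw [h3] at h2
  have h4 : (∫ r in Set.Ioi (0 : ℝ), r * Real.exp (-b * r ^ 2)) = (2 * b)⁻¹ := by
    exact_mod_cast h2
  rw [h4]; field_simp

lemma integral_abs_mul_gaussianPDFReal (t : ℝ) :
    ∫ v, |v| * gaussianPDFReal 0 1 (t * v) ∂(gaussianReal 0 1) =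
      1 / (Real.pi * (1 + t ^ 2)) := by
  rw [integral_gaussianReal_eq_integral_smul one_ne_zero]
  have h2π : (√(2 * Real.pi))⁻¹ * (√(2 * Real.pi))⁻¹ = (2 * Real.pi)⁻¹ := by
    rw [← mul_inv, Real.mul_self_sqrt (by positivity)]
  have : (fun x ↦ gaussianPDFReal 0 1 x • (|x| * gaussianPDFReal 0 1 (t * x))) =
      fun x ↦ (2 * Real.pi)⁻¹ * (|x| * Real.exp (-((1 + t ^ 2) / 2) * x ^ 2)) := by
    ext x
    have : Real.exp (-((1 + t ^ 2) / 2) * x ^ 2) =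
        Real.exp (-(x - 0) ^ 2 / (2 * (1 : ℝ≥0))) *
          Real.exp (-(t * x - 0) ^ 2 / (2 * (1 : ℝ≥0))) := by
      rw [← Real.exp_add]; congr 1; push_cast; ring
    rw [this, ← h2π]
    simp only [gaussianPDFReal, smul_eq_mul, NNReal.coe_one, mul_one]
    ring
  rw [this, integral_const_mul, integral_abs_mul_exp_neg_mul_sq (by positivity)]
  field_simp

/-- The quadratic component, in the Hermite expansion under the planar standard Gaussian measure, of
the indicator of the cone `|u| < t |v|` is `coneConstant t * (v ^ 2 - u ^ 2) / 2`. -/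
noncomputable def coneConstant (t : ℝ) : ℝ := 2 * t / (Real.pi * (1 + t ^ 2))

lemma coneConstant_pos {t : ℝ} (ht : 0 < t) : 0 < coneConstant t := by
  unfold coneConstant; positivity

lemma integrable_sq_sub_one : Integrable (fun u : ℝ ↦ u ^ 2 - 1) (gaussianReal 0 1) :=
  ((memLp_id_gaussianReal' 2 (by norm_num)).integrable_sq).sub (integrable_const 1)

lemma integral_sq_sub_one : ∫ u : ℝ, (u ^ 2 - 1) ∂(gaussianReal 0 1) = 0 := by
  have h := variance_fun_id_gaussianReal (μ := 0) (v := 1)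
  rw [variance_of_integral_eq_zero (X := fun x : ℝ ↦ x) aemeasurable_id (by simp)] at h
  have h2 : Integrable (fun x : ℝ ↦ x ^ 2) (gaussianReal 0 1) :=
    (memLp_id_gaussianReal' 2 (by norm_num)).integrable_sq
  rw [integral_sub h2 (integrable_const 1), h]
  simp

/-- The cone `|u| < t |v|` in the plane. -/
def cone (t : ℝ) : Set (ℝ × ℝ) := {x | |x.1| < t * |x.2|}

lemma measurableSet_cone (t : ℝ) : MeasurableSet (cone t) :=
  measurableSet_lt (by fun_prop) (by fun_prop)

lemma integrable_indicator_cone (t : ℝ) {f : ℝ × ℝ → ℝ}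
    (hf : Integrable f ((gaussianReal 0 1).prod (gaussianReal 0 1))) :
    Integrable ((cone t).indicator f) ((gaussianReal 0 1).prod (gaussianReal 0 1)) :=
  hf.indicator (measurableSet_cone t)

lemma integral_cone_fst_sq {t : ℝ} (ht : 0 < t) :
    ∫ x, (cone t).indicator (fun x ↦ x.1 ^ 2 - 1) x ∂((gaussianReal 0 1).prod (gaussianReal 0 1)) =
      -coneConstant t := by
  rw [integral_prod_symm _ (integrable_indicator_cone t (integrable_sq_sub_one.comp_fst _))]
  have : ∀ v : ℝ, ∫ u, (cone t).indicator (fun x : ℝ × ℝ ↦ x.1 ^ 2 - 1) (u, v)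
      ∂(gaussianReal 0 1) = -(2 * t) * (|v| * gaussianPDFReal 0 1 (t * v)) := by
    intro v
    have h := integral_indicator_gaussianReal_Ioo (s := t * |v|) (by positivity)
    have e : gaussianPDFReal 0 1 (t * |v|) = gaussianPDFReal 0 1 (t * v) := by
      simp [gaussianPDFReal, mul_pow]
    rw [e] at h
    rw [show -(2 * t) * (|v| * gaussianPDFReal 0 1 (t * v)) =
      -(2 * (t * |v|) * gaussianPDFReal 0 1 (t * v)) by ring, ← h]
    congr 1
    ext u
    simp only [Set.indicator, cone, Set.mem_ofPred_eq, Set.mem_Ioo, abs_lt]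
  simp_rw [this]
  rw [integral_const_mul, integral_abs_mul_gaussianPDFReal, coneConstant]
  ring

lemma integral_cone_snd_sq {t : ℝ} (ht : 0 < t) :
    ∫ x, (cone t).indicator (fun x ↦ x.2 ^ 2 - 1) x ∂((gaussianReal 0 1).prod (gaussianReal 0 1)) =
      coneConstant t := by
  have hI : Integrable (fun x : ℝ × ℝ ↦ x.2 ^ 2 - 1) ((gaussianReal 0 1).prod (gaussianReal 0 1)) :=
    integrable_sq_sub_one.comp_snd _
  have hcompl : (cone t).indicator (fun x ↦ x.2 ^ 2 - 1) =
      fun x : ℝ × ℝ ↦ (x.2 ^ 2 - 1) - (cone t)ᶜ.indicator (fun x ↦ x.2 ^ 2 - 1) x := by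
    ext x
    by_cases hx : x ∈ cone t <;> simp [hx]
  have hIc := hI.indicator (measurableSet_cone t).compl
  rw [hcompl, integral_sub hI hIc, integral_prod _ hI, integral_prod _ hIc]
  simp only [integral_sq_sub_one, integral_zero, zero_sub]
  have : ∀ u : ℝ, ∫ v, (cone t)ᶜ.indicator (fun x : ℝ × ℝ ↦ x.2 ^ 2 - 1) (u, v)
      ∂(gaussianReal 0 1) = -(2 * t⁻¹) * (|u| * gaussianPDFReal 0 1 (t⁻¹ * u)) := by
    intro u
    have h := integral_indicator_gaussianReal_Icc (s := t⁻¹ * |u|) (by positivity)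
    have e : gaussianPDFReal 0 1 (t⁻¹ * |u|) = gaussianPDFReal 0 1 (t⁻¹ * u) := by
      simp [gaussianPDFReal, mul_pow]
    rw [e] at h
    rw [show -(2 * t⁻¹) * (|u| * gaussianPDFReal 0 1 (t⁻¹ * u)) =
      -(2 * (t⁻¹ * |u|) * gaussianPDFReal 0 1 (t⁻¹ * u)) by ring, ← h]
    congr 1
    ext v
    have : t * |v| ≤ |u| ↔ |v| ≤ t⁻¹ * |u| := by
      rw [inv_mul_eq_div, le_div_iff₀ ht, mul_comm]
    simp only [Set.indicator, cone, Set.mem_ofPred_eq, Set.mem_compl_iff, not_lt, this, abs_le,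
      Set.mem_Icc]
  simp_rw [this]
  rw [integral_const_mul, integral_abs_mul_gaussianPDFReal, coneConstant]
  field_simp
  ring

lemma integral_cone_mul (t : ℝ) :
    ∫ x, (cone t).indicator (fun x ↦ x.1 * x.2) x ∂((gaussianReal 0 1).prod (gaussianReal 0 1)) =
      0 := by
  have hid : Integrable (fun u : ℝ ↦ u) (gaussianReal 0 1) :=
    (memLp_id_gaussianReal' 1 (by norm_num)).integrable le_rfl
  rw [integral_prod_symm _ (integrable_indicator_cone t (hid.mul_prod hid))]
  have : ∀ v : ℝ, ∫ u, (cone t).indicator (fun x : ℝ × ℝ ↦ x.1 * x.2) (u, v)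
      ∂(gaussianReal 0 1) = 0 := by
    intro v
    have hsym : (gaussianReal 0 1).map (fun x ↦ -x) = gaussianReal 0 1 := by
      simpa using gaussianReal_map_neg (μ := 0) (v := 1)
    have hm : Measurable fun u ↦ (cone t).indicator (fun x : ℝ × ℝ ↦ x.1 * x.2) (u, v) :=
      ((by fun_prop : Measurable fun x : ℝ × ℝ ↦ x.1 * x.2).indicator
        (measurableSet_cone t)).comp measurable_prodMk_right
    have h := integral_map (μ := gaussianReal 0 1) (φ := fun x : ℝ ↦ -x) (by fun_prop)
      hm.aestronglyMeasurable
    rw [hsym] at h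
    have hodd : (fun u ↦ (cone t).indicator (fun x : ℝ × ℝ ↦ x.1 * x.2) (-u, v)) =
        fun u ↦ -(cone t).indicator (fun x : ℝ × ℝ ↦ x.1 * x.2) (u, v) := by
      ext u
      by_cases hu : |u| < t * |v| <;> simp [Set.indicator, cone, hu]
    rw [hodd, integral_neg] at h
    linarith
  simp [this]

variable {Ω : Type*} [MeasurableSpace Ω] {P : Measure Ω}

/-- The covariance of the indicator of a cone with the square of a linear form, for a planar standard
Gaussian vector `(U, V)`. -/
lemma covariance_cone_sq {U V : Ω → ℝ} (h : HasGaussianLaw (fun ω ↦ (U ω, V ω)) P)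
    (hUm : ∫ ω, U ω ∂P = 0) (hVm : ∫ ω, V ω ∂P = 0) (hUV : cov[U, V; P] = 0)
    (hU1 : cov[U, U; P] = 1) (hV1 : cov[V, V; P] = 1) {t : ℝ} (ht : 0 < t) (a b : ℝ) :
    cov[fun ω ↦ (cone t).indicator (fun _ ↦ (1 : ℝ)) (U ω, V ω),
      fun ω ↦ (a * U ω + b * V ω) ^ 2; P] = coneConstant t * (b ^ 2 - a ^ 2) := by
  have := h.isProbabilityMeasure
  have hU : HasGaussianLaw U P := h.fst
  have hV : HasGaussianLaw V P := h.snd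
  have hUlaw : P.map U = gaussianReal 0 1 := by
    rw [hU.map_eq_gaussianReal, hUm, ← covariance_self hU.aemeasurable, hU1, Real.toNNReal_one]
  have hVlaw : P.map V = gaussianReal 0 1 := by
    rw [hV.map_eq_gaussianReal, hVm, ← covariance_self hV.aemeasurable, hV1, Real.toNNReal_one]
  have hlaw : P.map (fun ω ↦ (U ω, V ω)) = (gaussianReal 0 1).prod (gaussianReal 0 1) := by
    rw [(indepFun_iff_map_prod_eq_prod_map_map hU.aemeasurable hV.aemeasurable).1
      (h.indepFun_of_covariance_eq_zero hUV), hUlaw, hVlaw]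
  set ν := (gaussianReal 0 1).prod (gaussianReal 0 1) with hν
  have hid : MemLp (fun u : ℝ ↦ u) 2 (gaussianReal 0 1) := memLp_id_gaussianReal' 2 (by norm_num)
  have hId := hid.integrable (by norm_num)
  have hFm : Measurable ((cone t).indicator (fun _ ↦ (1 : ℝ))) :=
    measurable_const.indicator (measurableSet_cone t)
  have hQm : Measurable fun x : ℝ × ℝ ↦ (a * x.1 + b * x.2) ^ 2 := by fun_prop
  have hmap : cov[fun ω ↦ (cone t).indicator (fun _ ↦ (1 : ℝ)) (U ω, V ω),
      fun ω ↦ (a * U ω + b * V ω) ^ 2; P] = cov[(cone t).indicator (fun _ ↦ (1 : ℝ)),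
      fun x ↦ (a * x.1 + b * x.2) ^ 2; ν] := by
    rw [← hlaw, covariance_map hFm.aestronglyMeasurable hQm.aestronglyMeasurable h.aemeasurable]
    rfl
  have i1 : Integrable (fun x : ℝ × ℝ ↦ x.1 ^ 2 - 1) ν := integrable_sq_sub_one.comp_fst _
  have i2 : Integrable (fun x : ℝ × ℝ ↦ x.2 ^ 2 - 1) ν := integrable_sq_sub_one.comp_snd _
  have i3 : Integrable (fun x : ℝ × ℝ ↦ x.1 * x.2) ν := hId.mul_prod hId
  have hmean : ∫ x, (a * x.1 + b * x.2) ^ 2 ∂ν = a ^ 2 + b ^ 2 := by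
    have e : (fun x : ℝ × ℝ ↦ (a * x.1 + b * x.2) ^ 2) = fun x ↦ (a ^ 2 * (x.1 ^ 2 - 1) +
        b ^ 2 * (x.2 ^ 2 - 1)) + (2 * a * b * (x.1 * x.2) + (a ^ 2 + b ^ 2)) := by
      ext x; ring
    have j1 : Integrable (fun x : ℝ × ℝ ↦ a ^ 2 * (x.1 ^ 2 - 1) + b ^ 2 * (x.2 ^ 2 - 1)) ν :=
      (i1.const_mul _).add (i2.const_mul _)
    have j2 : Integrable (fun x : ℝ × ℝ ↦ 2 * a * b * (x.1 * x.2) + (a ^ 2 + b ^ 2)) ν :=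
      (i3.const_mul _).add (integrable_const _)
    rw [e, integral_add j1 j2, integral_add (i1.const_mul _) (i2.const_mul _),
      integral_add (i3.const_mul _) (integrable_const _), integral_const_mul, integral_const_mul,
      integral_const_mul, integral_prod _ i1, integral_prod_symm _ i2, hν,
      integral_prod_mul (fun x : ℝ ↦ x) (fun x : ℝ ↦ x)]
    simp [integral_sq_sub_one]
  rw [hmap, covariance, hmean]
  set e := ∫ x, (cone t).indicator (fun _ ↦ (1 : ℝ)) x ∂ν with he
  have hpt : (fun x : ℝ × ℝ ↦ ((cone t).indicator (fun _ ↦ (1 : ℝ)) x - e) *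
      ((a * x.1 + b * x.2) ^ 2 - (a ^ 2 + b ^ 2))) = fun x ↦
      (a ^ 2 * (cone t).indicator (fun x ↦ x.1 ^ 2 - 1) x +
        b ^ 2 * (cone t).indicator (fun x ↦ x.2 ^ 2 - 1) x) +
      (2 * a * b * (cone t).indicator (fun x ↦ x.1 * x.2) x -
        e * ((a * x.1 + b * x.2) ^ 2 - (a ^ 2 + b ^ 2))) := by
    ext x
    by_cases hx : x ∈ cone t <;> simp [hx]; ring
  have k1 := integrable_indicator_cone t i1
  have k2 := integrable_indicator_cone t i2
  have k3 := integrable_indicator_cone t i3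
  have k4 : Integrable (fun x : ℝ × ℝ ↦ (a * x.1 + b * x.2) ^ 2) ν :=
    (((hid.comp_fst _).const_mul a).add ((hid.comp_snd _).const_mul b)).integrable_sq
  have k12 : Integrable (fun x : ℝ × ℝ ↦ a ^ 2 * (cone t).indicator (fun x ↦ x.1 ^ 2 - 1) x +
        b ^ 2 * (cone t).indicator (fun x ↦ x.2 ^ 2 - 1) x) ν :=
    (k1.const_mul _).add (k2.const_mul _)
  have k4' : Integrable (fun x : ℝ × ℝ ↦ e * ((a * x.1 + b * x.2) ^ 2 - (a ^ 2 + b ^ 2))) ν :=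
    (k4.sub (integrable_const _)).const_mul e
  have k34 : Integrable (fun x : ℝ × ℝ ↦ 2 * a * b * (cone t).indicator (fun x ↦ x.1 * x.2) x -
        e * ((a * x.1 + b * x.2) ^ 2 - (a ^ 2 + b ^ 2))) ν := (k3.const_mul _).sub k4'
  rw [hpt, integral_add k12 k34, integral_add (k1.const_mul _) (k2.const_mul _),
    integral_sub (k3.const_mul _) k4', integral_const_mul, integral_const_mul, integral_const_mul,
    integral_const_mul, integral_sub k4 (integrable_const _), hmean, integral_cone_fst_sq ht,
    integral_cone_snd_sq ht, integral_cone_mul]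
  simp only [integral_const, probReal_univ, smul_eq_mul, one_mul]
  ring

end QuadraticComponent

/-! ### Cesàro limits of Toeplitz double sums -/

section Cesaro

lemma sum_Icc_neg_succ (c : ℤ → ℝ) (m : ℕ) :
    ∑ k ∈ Finset.Icc (-((m + 1 : ℕ) : ℤ)) (m + 1 : ℕ), c k =
      ∑ k ∈ Finset.Icc (-(m : ℤ)) m, c k + c (m + 1) + c (-(m + 1)) := by
  have h : Finset.Icc (-((m + 1 : ℕ) : ℤ)) (m + 1 : ℕ) =
      insert (-((m : ℤ) + 1)) (insert ((m : ℤ) + 1) (Finset.Icc (-(m : ℤ)) m)) := by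
    ext k; simp only [Finset.mem_Icc, Finset.mem_insert]; push_cast; omega
  rw [h, Finset.sum_insert (by simp only [Finset.mem_Icc, Finset.mem_insert]; omega),
    Finset.sum_insert (by simp only [Finset.mem_Icc]; omega)]
  ring

lemma sum_Icc_neg_eq (c : ℤ → ℝ) (m : ℕ) :
    ∑ k ∈ Finset.Icc (-(m : ℤ)) m, c k =
      c 0 + ∑ j ∈ Finset.range m, c (m - j) + ∑ l ∈ Finset.range m, c (l - m) := by
  induction m with
  | zero => simp
  | succ m ih =>
    rw [sum_Icc_neg_succ, ih, Finset.sum_range_succ', Finset.sum_range_succ']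
    push_cast
    simp only [sub_zero, zero_sub, add_sub_add_right_eq_sub]
    ring

lemma sum_range_sum_range_sub (c : ℤ → ℝ) (n : ℕ) :
    ∑ j ∈ Finset.range n, ∑ l ∈ Finset.range n, c ((l : ℤ) - j) =
      ∑ m ∈ Finset.range n, ∑ k ∈ Finset.Icc (-(m : ℤ)) m, c k := by
  induction n with
  | zero => simp
  | succ n ih =>
    rw [Finset.sum_range_succ, Finset.sum_range_succ _ n]
    simp_rw [Finset.sum_range_succ _ n, Finset.sum_add_distrib]
    rw [ih, sum_Icc_neg_eq]
    simp only [sub_self]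
    ring

lemma tendsto_sum_Icc_neg {c : ℤ → ℝ} (hc : Summable c) :
    Tendsto (fun m : ℕ ↦ ∑ k ∈ Finset.Icc (-(m : ℤ)) m, c k) atTop (𝓝 (∑' k, c k)) :=
  hc.hasSum.comp (Finset.tendsto_Icc_neg_atTop_atTop.comp tendsto_natCast_atTop_atTop)

/-- The normalized double sums of a summable Toeplitz array converge to the sum of its symbol. -/
lemma tendsto_inv_mul_sum_range_sum_range_sub {c : ℤ → ℝ} (hc : Summable c) :
    Tendsto (fun n : ℕ ↦ (n : ℝ)⁻¹ *
      ∑ j ∈ Finset.range n, ∑ l ∈ Finset.range n, c ((l : ℤ) - j)) atTop (𝓝 (∑' k, c k)) := by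
  simp_rw [sum_range_sum_range_sub]
  exact (tendsto_sum_Icc_neg hc).cesaro

/-- The convergence in `tendsto_inv_mul_sum_range_sum_range_sub` is uniform over all arrays with a
common summable bound. -/
lemma abs_inv_mul_sum_range_sum_range_sub_sub_tsum_le {b c : ℤ → ℝ} (hb : Summable b)
    (hcb : ∀ k, |c k| ≤ b k) {n : ℕ} (hn : n ≠ 0) :
    |(n : ℝ)⁻¹ * ∑ j ∈ Finset.range n, ∑ l ∈ Finset.range n, c ((l : ℤ) - j) - ∑' k, c k| ≤
      (n : ℝ)⁻¹ * ∑ m ∈ Finset.range n, (∑' k, b k - ∑ k ∈ Finset.Icc (-(m : ℤ)) m, b k) := by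
  have hc : Summable c := Summable.of_norm_bounded hb hcb
  have hn0 : (n : ℝ) ≠ 0 := Nat.cast_ne_zero.2 hn
  have e : (n : ℝ)⁻¹ * ∑ j ∈ Finset.range n, ∑ l ∈ Finset.range n, c ((l : ℤ) - j) - ∑' k, c k =
      (n : ℝ)⁻¹ * ∑ m ∈ Finset.range n, (∑ k ∈ Finset.Icc (-(m : ℤ)) m, c k - ∑' k, c k) := by
    rw [sum_range_sum_range_sub, Finset.sum_sub_distrib, Finset.sum_const, Finset.card_range,
      nsmul_eq_mul, mul_sub, inv_mul_cancel_left₀ hn0]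
  rw [e, abs_mul, abs_of_nonneg (by positivity : (0 : ℝ) ≤ (n : ℝ)⁻¹)]
  gcongr
  refine (Finset.abs_sum_le_sum_abs _ _).trans (Finset.sum_le_sum fun m _ ↦ ?_)
  rw [abs_sub_comm, ← hc.sum_add_tsum_compl (s := Finset.Icc (-(m : ℤ)) m),
    ← hb.sum_add_tsum_compl (s := Finset.Icc (-(m : ℤ)) m), add_sub_cancel_left,
    add_sub_cancel_left]
  exact tsum_of_norm_bounded (f := fun k : {k // k ∉ Finset.Icc (-(m : ℤ)) m} ↦ c k)
    (hb.subtype _).hasSum fun k ↦ hcb k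

lemma tendsto_inv_mul_sum_tail {b : ℤ → ℝ} (hb : Summable b) :
    Tendsto (fun n : ℕ ↦ (n : ℝ)⁻¹ *
      ∑ m ∈ Finset.range n, (∑' k, b k - ∑ k ∈ Finset.Icc (-(m : ℤ)) m, b k)) atTop (𝓝 0) := by
  have h := (tendsto_sum_Icc_neg hb).const_sub (∑' k, b k)
  rw [sub_self] at h
  exact h.cesaro

end Cesaro

/-! ### Sign changes of a stationary Gaussian sequence -/

section Stationary

variable {Ω : Type*} [MeasurableSpace Ω] {P : Measure Ω}

/-- `Y` is a centred stationary Gaussian sequence of variance one with autocovariance function `ρ`,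
regarded as a function on the integers. -/
structure IsStationaryGaussian (Y : ℕ → Ω → ℝ) (ρ : ℤ → ℝ) (P : Measure Ω) : Prop where
  gaussian : IsGaussianProcess Y P
  mean_zero : ∀ k, ∫ ω, Y k ω ∂P = 0
  covariance : ∀ j l : ℕ, cov[Y j, Y l; P] = ρ ((l : ℤ) - j)
  variance_one : ρ 0 = 1

/-- The indicator of the event that `Y k` and `Y (k + 1)` have opposite signs. -/
noncomputable def signChange (Y : ℕ → Ω → ℝ) (k : ℕ) (ω : Ω) : ℝ :=
  Set.indicator {ω | Y k ω * Y (k + 1) ω < 0} (fun _ ↦ (1 : ℝ)) ω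

/-- The signs `1` and `-1`. -/
def pmOne : Fin 2 → ℝ := ![1, -1]

/-- The normalized sum (`i = 0`) and the normalized difference (`i = 1`) of `Y k` and `Y (k + 1)`,
where `r` is the correlation of these two variables. -/
noncomputable def normalizedPair (r : ℝ) (Y : ℕ → Ω → ℝ) (k : ℕ) (i : Fin 2) (ω : Ω) : ℝ :=
  (Y k ω + pmOne i * Y (k + 1) ω) / √(2 * (1 + pmOne i * r))

lemma pmOne_sq (i : Fin 2) : pmOne i ^ 2 = 1 := by fin_cases i <;> simp [pmOne]

lemma hasGaussianLaw_comp {T ι : Type*} [Fintype ι] {X : T → Ω → ℝ} (h : IsGaussianProcess X P)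
    (f : ι → T) : HasGaussianLaw (fun ω i ↦ X (f i) ω) P :=
  ((h.comp_right f).hasGaussianLaw Finset.univ).map_fun
    (ContinuousLinearMap.pi fun i ↦ ContinuousLinearMap.proj (⟨i, Finset.mem_univ i⟩ :
      (Finset.univ : Finset ι)))

omit [MeasurableSpace Ω] in
lemma abs_signChange_le (Y : ℕ → Ω → ℝ) (k : ℕ) (ω : Ω) : |signChange Y k ω| ≤ 1 := by
  unfold signChange
  by_cases h : ω ∈ {ω | Y k ω * Y (k + 1) ω < 0} <;> simp [h]

namespace IsStationaryGaussian

variable {Y : ℕ → Ω → ℝ} {ρ : ℤ → ℝ}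

section
variable (hY : IsStationaryGaussian Y ρ P)
include hY

lemma hasGaussianLaw (k : ℕ) : HasGaussianLaw (Y k) P := hY.gaussian.hasGaussianLaw_eval k

lemma isProbabilityMeasure : IsProbabilityMeasure P := (hY.hasGaussianLaw 0).isProbabilityMeasure

lemma even (k : ℤ) : ρ (-k) = ρ k := by
  have h (n : ℕ) : ρ (-(n : ℤ)) = ρ n := by
    have h1 := hY.covariance 0 n
    have h2 := hY.covariance n 0
    rw [covariance_comm, h2] at h1
    simpa using h1
  rcases Int.natAbs_eq k with hk | hk
  · rw [hk]; exact h _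
  · rw [hk, neg_neg]; exact (h _).symm

lemma hasGaussianLaw_normalizedPair (r : ℝ) (j l : ℕ) :
    HasGaussianLaw (fun ω ↦ ((fun i ↦ normalizedPair r Y j i ω),
      (fun i ↦ normalizedPair r Y l i ω))) P := by
  have h := hasGaussianLaw_comp hY.gaussian ![j, j + 1, l, l + 1]
  let L : (Fin 4 → ℝ) →L[ℝ] (Fin 2 → ℝ) × (Fin 2 → ℝ) :=
    (ContinuousLinearMap.pi fun i ↦ (√(2 * (1 + pmOne i * r)))⁻¹ •
      (ContinuousLinearMap.proj 0 + pmOne i • ContinuousLinearMap.proj 1)).prod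
    (ContinuousLinearMap.pi fun i ↦ (√(2 * (1 + pmOne i * r)))⁻¹ •
      (ContinuousLinearMap.proj 2 + pmOne i • ContinuousLinearMap.proj 3))
  convert! h.map_fun L using 2 with ω
  simp only [L, ContinuousLinearMap.prod_apply, Prod.mk.injEq]
  constructor
  · ext i; simp [normalizedPair, div_eq_inv_mul]; ring
  · ext i; simp [normalizedPair, div_eq_inv_mul]; ring

lemma hasGaussianLaw_normalizedPair_apply (r : ℝ) (j : ℕ) (i : Fin 2) :
    HasGaussianLaw (normalizedPair r Y j i) P :=
  (hY.hasGaussianLaw_normalizedPair r j j).fst.eval i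

lemma integral_normalizedPair (r : ℝ) (j : ℕ) (i : Fin 2) :
    ∫ ω, normalizedPair r Y j i ω ∂P = 0 := by
  simp only [normalizedPair]
  rw [integral_div, integral_add (hY.hasGaussianLaw j).integrable
    ((hY.hasGaussianLaw (j + 1)).integrable.const_mul _), integral_const_mul, hY.mean_zero,
    hY.mean_zero]
  simp

lemma covariance_normalizedPair (r : ℝ) (j l : ℕ) (i i' : Fin 2) :
    cov[normalizedPair r Y j i, normalizedPair r Y l i'; P] =
      ((1 + pmOne i * pmOne i') * ρ ((l : ℤ) - j) + pmOne i' * ρ ((l : ℤ) - j + 1) +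
        pmOne i * ρ ((l : ℤ) - j - 1)) /
        (√(2 * (1 + pmOne i * r)) * √(2 * (1 + pmOne i' * r))) := by
  have := hY.isProbabilityMeasure
  have h2 k : MemLp (Y k) 2 P := (hY.hasGaussianLaw k).memLp_two
  have h2' k (a : ℝ) : MemLp (fun ω ↦ a * Y k ω) 2 P := (h2 k).const_mul a
  unfold normalizedPair
  rw [covariance_fun_div_left, covariance_fun_div_right]
  have e (k : ℕ) (a : ℝ) : (fun ω ↦ Y k ω + a * Y (k + 1) ω) = Y k + fun ω ↦ a * Y (k + 1) ω := rfl
  rw [e, e, covariance_add_left (h2 _) (h2' _ _) ((h2 _).add (h2' _ _)),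
    covariance_add_right (h2 _) (h2 _) (h2' _ _), covariance_add_right (h2' _ _) (h2 _) (h2' _ _),
    covariance_const_mul_left, covariance_const_mul_left, covariance_const_mul_right,
    covariance_const_mul_right, hY.covariance, hY.covariance, hY.covariance, hY.covariance]
  push_cast
  rw [div_div, mul_comm (√_) (√_), show (l : ℤ) + 1 - j = l - j + 1 by ring,
    show (l : ℤ) - (j + 1) = l - j - 1 by ring, show (l : ℤ) + 1 - (j + 1) = l - j by ring]
  congr 1
  ring

end

section
variable (hY : IsStationaryGaussian Y ρ P) (hr : |ρ 1| < 1)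
include hr

lemma one_add_pmOne_mul_pos (i : Fin 2) : 0 < 1 + pmOne i * ρ 1 := by
  have := abs_lt.1 hr
  fin_cases i <;> simp [pmOne] <;> linarith

include hY

lemma covariance_normalizedPair_self (j : ℕ) (i : Fin 2) :
    cov[normalizedPair (ρ 1) Y j i, normalizedPair (ρ 1) Y j i; P] = 1 := by
  have hp := one_add_pmOne_mul_pos hr i
  rw [hY.covariance_normalizedPair, Real.mul_self_sqrt (by positivity), sub_self, zero_add,
    zero_sub, hY.even, hY.variance_one, ← sq, pmOne_sq]
  rw [div_eq_one_iff_eq (by positivity)]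
  ring

omit hr in
lemma covariance_normalizedPair_of_ne (j : ℕ) {i i' : Fin 2} (h : i ≠ i') :
    cov[normalizedPair (ρ 1) Y j i, normalizedPair (ρ 1) Y j i'; P] = 0 := by
  rw [hY.covariance_normalizedPair, sub_self, zero_add, zero_sub, hY.even, hY.variance_one]
  have : pmOne i' = -pmOne i := by
    fin_cases i <;> fin_cases i' <;> simp_all [pmOne]
  have h2 := pmOne_sq i
  rw [this, show (1 + pmOne i * -pmOne i) * 1 + -pmOne i * ρ 1 + pmOne i * ρ 1 = 1 - pmOne i ^ 2
    by ring, h2]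
  simp

omit [MeasurableSpace Ω] hY in
/-- A sign change occurs when the normalized sum and difference lie in a cone. -/
lemma signChange_eq_indicator_cone (k : ℕ) (ω : Ω) :
    signChange Y k ω = (cone (√((1 - ρ 1) / (1 + ρ 1)))).indicator (fun _ ↦ (1 : ℝ))
      (normalizedPair (ρ 1) Y k 0 ω, normalizedPair (ρ 1) Y k 1 ω) := by
  have h0 := one_add_pmOne_mul_pos hr 0
  have h1 := one_add_pmOne_mul_pos hr 1
  simp only [pmOne, Matrix.cons_val_zero, Matrix.cons_val_one, one_mul, neg_one_mul] at h0 h1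
  rw [← sub_eq_add_neg] at h1
  have key : Y k ω * Y (k + 1) ω < 0 ↔
      (normalizedPair (ρ 1) Y k 0 ω, normalizedPair (ρ 1) Y k 1 ω) ∈
        cone (√((1 - ρ 1) / (1 + ρ 1))) := by
    simp only [cone, Set.mem_ofPred_eq, normalizedPair, pmOne, Matrix.cons_val_zero,
      Matrix.cons_val_one, one_mul, neg_one_mul]
    rw [← sub_eq_add_neg, ← sub_eq_add_neg, abs_div, abs_div, abs_of_nonneg (Real.sqrt_nonneg _),
      abs_of_nonneg (Real.sqrt_nonneg _), Real.sqrt_div h1.le, Real.sqrt_mul zero_le_two,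
      Real.sqrt_mul zero_le_two]
    have s0 := Real.sqrt_pos.2 h0
    have s1 := Real.sqrt_pos.2 h1
    have s2 : 0 < √(2 : ℝ) := Real.sqrt_pos.2 zero_lt_two
    rw [show √(1 - ρ 1) / √(1 + ρ 1) * (|Y k ω - Y (k + 1) ω| / (√2 * √(1 - ρ 1))) =
      |Y k ω - Y (k + 1) ω| / (√2 * √(1 + ρ 1)) by field_simp,
      div_lt_div_iff_of_pos_right (by positivity), ← sq_lt_sq]
    constructor <;> intro h <;> nlinarith
  unfold signChange
  by_cases h : Y k ω * Y (k + 1) ω < 0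
  · rw [Set.indicator_of_mem (show ω ∈ {ω | Y k ω * Y (k + 1) ω < 0} from h),
      Set.indicator_of_mem (key.1 h)]
  · rw [Set.indicator_of_notMem (show ω ∉ {ω | Y k ω * Y (k + 1) ω < 0} from h),
      Set.indicator_of_notMem (fun h' ↦ h (key.2 h'))]

lemma aemeasurable_signChange (k : ℕ) : AEMeasurable (signChange Y k) P := by
  rw [funext (signChange_eq_indicator_cone (Y := Y) hr k)]
  exact (measurable_const.indicator (measurableSet_cone _)).comp_aemeasurable
    ((hY.hasGaussianLaw_normalizedPair_apply _ k 0).aemeasurable.prodMk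
      (hY.hasGaussianLaw_normalizedPair_apply _ k 1).aemeasurable)

lemma memLp_signChange (k : ℕ) : MemLp (signChange Y k) 2 P :=
  have := hY.isProbabilityMeasure
  memLp_two_of_abs_le (hY.aemeasurable_signChange hr k) (abs_signChange_le Y k)

end

/-- Sign changes decorrelate like the squares of the autocovariances. -/
lemma abs_covariance_signChange_le (hY : IsStationaryGaussian Y ρ P) (hr : |ρ 1| ≤ 1 / 2)
    (j l : ℕ) :
    |cov[signChange Y j, signChange Y l; P]| ≤ 1600 * (ρ ((l : ℤ) - j - 1) ^ 2 +
      ρ ((l : ℤ) - j) ^ 2 + ρ ((l : ℤ) - j + 1) ^ 2) := by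
  have hr1 : |ρ 1| < 1 := by linarith
  have := hY.isProbabilityMeasure
  set k : ℤ := (l : ℤ) - j with hk
  set S := ρ (k - 1) ^ 2 + ρ k ^ 2 + ρ (k + 1) ^ 2 with hS
  have hS0 : 0 ≤ S := by positivity
  -- `4 * √S` bounds the cross-covariances of the normalized pairs; `1 / 10` is the threshold of
  -- `abs_covariance_le_of_even`
  rcases le_or_gt (4 * √S) (1 / 10) with hε | hε
  · have hcross i i' : |cov[normalizedPair (ρ 1) Y j i, normalizedPair (ρ 1) Y l i'; P]| ≤
        4 * √S := by
      rw [hY.covariance_normalizedPair, ← hk, abs_div]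
      have hden i : 1 ≤ √(2 * (1 + pmOne i * ρ 1)) := by
        rw [Real.one_le_sqrt]
        have := abs_le.1 hr
        fin_cases i <;> simp [pmOne] <;> linarith
      have hden' : 1 ≤ |√(2 * (1 + pmOne i * ρ 1)) * √(2 * (1 + pmOne i' * ρ 1))| := by
        rw [abs_mul, abs_of_nonneg (Real.sqrt_nonneg _), abs_of_nonneg (Real.sqrt_nonneg _)]
        exact one_le_mul_of_one_le_of_one_le (hden i) (hden i')
      refine (div_le_self (abs_nonneg _) hden').trans ?_
      have a1 : |ρ (k - 1)| ≤ √S := Real.abs_le_sqrt (by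
        rw [hS]; nlinarith [sq_nonneg (ρ k), sq_nonneg (ρ (k + 1))])
      have a2 : |ρ k| ≤ √S := Real.abs_le_sqrt (by
        rw [hS]; nlinarith [sq_nonneg (ρ (k - 1)), sq_nonneg (ρ (k + 1))])
      have a3 : |ρ (k + 1)| ≤ √S := Real.abs_le_sqrt (by
        rw [hS]; nlinarith [sq_nonneg (ρ k), sq_nonneg (ρ (k - 1))])
      have b1 := abs_le.1 a1; have b2 := abs_le.1 a2; have b3 := abs_le.1 a3
      rw [abs_le]
      fin_cases i <;> fin_cases i' <;> simp [pmOne] <;> constructor <;>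
        linarith [b1.1, b1.2, b2.1, b2.2, b3.1, b3.2]
    let F : (Fin 2 → ℝ) → ℝ := fun x ↦
      (cone (√((1 - ρ 1) / (1 + ρ 1)))).indicator (fun _ ↦ (1 : ℝ)) (x 0, x 1)
    have hF : Measurable F := (measurable_const.indicator (measurableSet_cone _)).comp (by fun_prop)
    have hF1 x : |F x| ≤ 1 := by
      simp only [F]
      by_cases h : (x 0, x 1) ∈ cone (√((1 - ρ 1) / (1 + ρ 1))) <;> simp [h]
    have hFe x : F (fun i ↦ -x i) = F x := by
      by_cases h : |x 0| < √((1 - ρ 1) / (1 + ρ 1)) * |x 1| <;> simp [F, Set.indicator, cone, h]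
    have h := abs_covariance_le_of_even (hY.hasGaussianLaw_normalizedPair (ρ 1) j l)
      (hY.integral_normalizedPair _ j) (hY.integral_normalizedPair _ l)
      (fun i i' h ↦ hY.covariance_normalizedPair_of_ne j h)
      (hY.covariance_normalizedPair_self hr1 j)
      (fun i i' h ↦ hY.covariance_normalizedPair_of_ne l h)
      (hY.covariance_normalizedPair_self hr1 l) hε hcross hF hF1 hF hF1 hFe
    rw [funext (signChange_eq_indicator_cone (Y := Y) hr1 j),
      funext (signChange_eq_indicator_cone (Y := Y) hr1 l)]
    refine h.trans ?_
    rw [mul_pow, Real.sq_sqrt hS0]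
    linarith
  · -- `S` is at least `1 / 1600`, and the trivial bound suffices
    have hS1 : 1 ≤ 1600 * S := by
      have h1 : 1 / 40 < √S := by linarith
      have h2 := Real.sq_sqrt hS0
      nlinarith
    have hb (k : ℕ) : ∀ ω, 0 ≤ signChange Y k ω ∧ signChange Y k ω ≤ 1 := by
      intro ω
      refine ⟨?_, (le_abs_self _).trans (abs_signChange_le Y k ω)⟩
      exact Set.indicator_nonneg (fun _ _ ↦ zero_le_one) _
    have hI (k : ℕ) : Integrable (signChange Y k) P :=
      (hY.memLp_signChange hr1 k).integrable (by norm_num)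
    have hE (k : ℕ) : 0 ≤ ∫ ω, signChange Y k ω ∂P ∧ ∫ ω, signChange Y k ω ∂P ≤ 1 := by
      refine ⟨integral_nonneg fun ω ↦ (hb k ω).1, ?_⟩
      have := integral_mono (hI k) (integrable_const 1) fun ω ↦ (hb k ω).2
      simpa using this
    have hcov := covariance_eq_sub (hY.memLp_signChange hr1 j) (hY.memLp_signChange hr1 l)
    have hIm : Integrable (fun ω ↦ signChange Y j ω * signChange Y l ω) P :=
      (hY.memLp_signChange hr1 j).integrable_mul (hY.memLp_signChange hr1 l)
    have hEm : 0 ≤ ∫ ω, signChange Y j ω * signChange Y l ω ∂P ∧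
        ∫ ω, signChange Y j ω * signChange Y l ω ∂P ≤ 1 := by
      refine ⟨integral_nonneg fun ω ↦ mul_nonneg (hb j ω).1 (hb l ω).1, ?_⟩
      have := integral_mono hIm (integrable_const 1) fun ω ↦
        mul_le_one₀ (hb j ω).2 (hb l ω).1 (hb l ω).2
      simpa using this
    simp only [Pi.mul_apply] at hcov
    rw [hcov, abs_le]
    have h1 := mul_nonneg (hE j).1 (hE l).1
    have h2 := mul_le_one₀ (hE j).2 (hE l).1 (hE l).2
    constructor <;> linarith [hEm.1, hEm.2]

/-- The covariances of sign changes depend on the time lag only. -/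
lemma covariance_signChange_eq (hY : IsStationaryGaussian Y ρ P) (j l : ℕ) :
    cov[signChange Y j, signChange Y l; P] =
      cov[signChange Y 0, signChange Y ((l : ℤ) - j).natAbs; P] := by
  have aux (j k : ℕ) : cov[signChange Y j, signChange Y (j + k); P] =
      cov[signChange Y 0, signChange Y k; P] := by
    let g (a : Fin 2 → Fin 4) (x : Fin 4 → ℝ) : ℝ :=
      Set.indicator {x : Fin 4 → ℝ | x (a 0) * x (a 1) < 0} (fun _ ↦ (1 : ℝ)) x
    have hg a : Measurable (g a) :=
      measurable_const.indicator (measurableSet_lt (by fun_prop) (by fun_prop))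
    have hfact (j : ℕ) : cov[signChange Y j, signChange Y (j + k); P] =
        cov[g ![0, 1], g ![2, 3]; P.map fun ω i ↦ Y (![j, j + 1, j + k, j + k + 1] i) ω] := by
      rw [covariance_map (hg _).aestronglyMeasurable (hg _).aestronglyMeasurable
        (hasGaussianLaw_comp hY.gaussian _).aemeasurable]
      rfl
    have h0 := hfact 0
    rw [zero_add] at h0
    rw [hfact, h0]
    congr 1
    refine map_eq_of_mean_of_covariance (X := fun i ↦ Y (![j, j + 1, j + k, j + k + 1] i))
      (Y := fun i ↦ Y (![0, 0 + 1, k, k + 1] i))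
      (hasGaussianLaw_comp hY.gaussian _) (hasGaussianLaw_comp hY.gaussian _)
      (fun i ↦ by rw [hY.mean_zero, hY.mean_zero]) fun a b ↦ ?_
    rw [hY.covariance, hY.covariance]
    have hshift (a : Fin 4) : ((![j, j + 1, j + k, j + k + 1] a : ℕ) : ℤ) =
        j + (![0, 0 + 1, k, k + 1] a : ℕ) := by
      fin_cases a <;> simp [add_assoc]
    rw [hshift, hshift]
    congr 1
    ring
  rcases le_total j l with h | h
  · obtain ⟨k, rfl⟩ := Nat.exists_eq_add_of_le h
    rw [aux]; congr 2; push_cast; simp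
  · obtain ⟨k, rfl⟩ := Nat.exists_eq_add_of_le h
    rw [covariance_comm, aux]; congr 2; push_cast; simp

end IsStationaryGaussian

end Stationary

/-! ### Positivity of the asymptotic variance -/

section LagSums

/-- The square of the covariance of the `i`-th component of the normalized pair at some time with the
`i'`-th component of the normalized pair `k` time steps later, for autocovariances `ρ`. -/
noncomputable def lagSq (ρ : ℤ → ℝ) (i i' : Fin 2) (k : ℤ) : ℝ :=
  ((1 + pmOne i * pmOne i') * ρ k + pmOne i' * ρ (k + 1) + pmOne i * ρ (k - 1)) ^ 2 /
    (4 * (1 + pmOne i * ρ 1) * (1 + pmOne i' * ρ 1))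

/-- The covariance at lag `k` of the differences of the squares of the two components of the
normalized pair, up to a constant factor. -/
noncomputable def lagForm (ρ : ℤ → ℝ) (k : ℤ) : ℝ :=
  lagSq ρ 1 1 k + lagSq ρ 0 0 k - lagSq ρ 0 1 k - lagSq ρ 1 0 k

variable {ρ : ℤ → ℝ}

lemma summable_sq_shift (h : Summable fun k ↦ ρ k ^ 2) (m : ℤ) :
    Summable fun k ↦ ρ (k + m) ^ 2 :=
  (Equiv.addRight m).summable_iff.2 h

lemma tsum_sq_shift (m : ℤ) : ∑' k, ρ (k + m) ^ 2 = ∑' k, ρ k ^ 2 :=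
  (Equiv.addRight m).tsum_eq (fun k ↦ ρ k ^ 2)

lemma summable_sq_combination (h : Summable fun k ↦ ρ k ^ 2) (a b c : ℝ) :
    Summable fun k ↦ (a * ρ k + b * ρ (k + 1) + c * ρ (k - 1)) ^ 2 := by
  have h1 := (((h.mul_left (3 * a ^ 2)).add ((summable_sq_shift h 1).mul_left (3 * b ^ 2))).add
    ((summable_sq_shift h (-1)).mul_left (3 * c ^ 2)))
  refine Summable.of_nonneg_of_le (fun k ↦ sq_nonneg _) (fun k ↦ ?_) h1
  rw [← sub_eq_add_neg k 1]
  nlinarith [sq_nonneg (a * ρ k - b * ρ (k + 1)), sq_nonneg (a * ρ k - c * ρ (k - 1)),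
    sq_nonneg (b * ρ (k + 1) - c * ρ (k - 1))]

lemma summable_lagForm (h : Summable fun k ↦ ρ k ^ 2) : Summable (lagForm ρ) := by
  have h1 i i' : Summable (lagSq ρ i i') := (summable_sq_combination h _ _ _).div_const _
  exact (((h1 1 1).add (h1 0 0)).sub (h1 0 1)).sub (h1 1 0)

/-- Summing `lagForm` by parts exhibits the sum as a sum of squares. If it vanished, `ρ` would solve
the linear recurrence `ρ (k + 1) + ρ (k - 1) = 2 * ρ 1 * ρ k`, whose first integral
`ρ k ^ 2 + ρ (k + 1) ^ 2 - 2 * ρ 1 * ρ k * ρ (k + 1)` is incompatible with decay. -/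
lemma tsum_lagForm_pos (h : Summable fun k ↦ ρ k ^ 2) (h0 : ρ 0 = 1) (hr : |ρ 1| < 1) :
    0 < ∑' k, lagForm ρ k := by
  obtain ⟨hr1, hr2⟩ := abs_lt.1 hr
  set r := ρ 1 with hrdef
  have hD : 0 < 1 - r ^ 2 := by nlinarith
  let q : ℤ → ℝ := fun k ↦ -r * ρ k + 1 / 2 * ρ (k + 1) + 1 / 2 * ρ (k - 1)
  have hq : Summable fun k ↦ q k ^ 2 := summable_sq_combination h _ _ _
  have hp := summable_sq_shift h 1
  have hm := summable_sq_shift h (-1)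
  have hform k : lagForm ρ k = 4 / (1 - r ^ 2) ^ 2 * q k ^ 2 +
      1 / (1 - r ^ 2) * (2 * ρ k ^ 2 - ρ (k + 1) ^ 2 - ρ (k + -1) ^ 2) := by
    have d1 : 1 + r ≠ 0 := by linarith
    have d2 : 1 - r ≠ 0 := by linarith
    have d3 : 1 - r ^ 2 = (1 + r) * (1 - r) := by ring
    rw [d3, ← sub_eq_add_neg k 1]
    simp only [lagForm, lagSq, q, pmOne, Matrix.cons_val_zero, Matrix.cons_val_one, one_mul,
      neg_one_mul, ← hrdef, ← sub_eq_add_neg]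
    field_simp
    ring
  have hsum : ∑' k, lagForm ρ k = 4 / (1 - r ^ 2) ^ 2 * ∑' k, q k ^ 2 := by
    simp_rw [hform]
    have s1 := ((h.mul_left 2).sub hp).sub hm
    rw [(hq.mul_left _).tsum_add (s1.mul_left _), tsum_mul_left, tsum_mul_left,
      ((h.mul_left 2).sub hp).tsum_sub hm, (h.mul_left 2).tsum_sub hp, tsum_mul_left,
      tsum_sq_shift, tsum_sq_shift]
    ring
  rw [hsum]
  refine mul_pos (by positivity) ?_
  by_contra hcon
  have hzero : ∑' k, q k ^ 2 = 0 := le_antisymm (not_lt.1 hcon) (tsum_nonneg fun k ↦ sq_nonneg _)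
  have hq0 (k : ℤ) : q k = 0 := by
    have h1 := hq.le_tsum k fun j _ ↦ sq_nonneg (q j)
    rw [hzero] at h1
    exact pow_eq_zero_iff two_ne_zero |>.1 (le_antisymm h1 (sq_nonneg _))
  have hinv (n : ℕ) : ρ n ^ 2 + ρ (n + 1) ^ 2 - 2 * r * ρ n * ρ (n + 1) = 1 - r ^ 2 := by
    induction n with
    | zero => simp only [Nat.cast_zero, zero_add, h0, ← hrdef]; ring
    | succ n ih =>
      have h1 := hq0 (n + 1)
      simp only [q, add_sub_cancel_right] at h1
      push_cast
      rw [← ih]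
      linear_combination (2 * ρ (n + 1 + 1) - 2 * ρ n) * h1
  have htend : Tendsto (fun n : ℕ ↦ ρ n) atTop (𝓝 0) := by
    have h1 : Tendsto (fun n : ℕ ↦ ρ n ^ 2) atTop (𝓝 0) :=
      (h.comp_injective Nat.cast_injective).tendsto_atTop_zero
    have h2 := h1.sqrt
    simp only [Real.sqrt_sq_eq_abs, Real.sqrt_zero] at h2
    exact (tendsto_zero_iff_abs_tendsto_zero _).2 h2
  have htend1 : Tendsto (fun n : ℕ ↦ ρ (n + 1)) atTop (𝓝 0) := by
    have := (tendsto_add_atTop_iff_nat 1).2 htend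
    simpa using this
  have hlim := ((htend.pow 2).add (htend1.pow 2)).sub ((htend.const_mul (2 * r)).mul htend1)
  simp_rw [hinv] at hlim
  have := tendsto_nhds_unique hlim tendsto_const_nhds
  norm_num at this
  linarith

end LagSums

section Positivity

namespace IsStationaryGaussian

variable {Ω : Type*} [MeasurableSpace Ω] {P : Measure Ω} {Y : ℕ → Ω → ℝ} {ρ : ℤ → ℝ}

lemma covariance_normalizedPair_sq (hY : IsStationaryGaussian Y ρ P) (hr : |ρ 1| < 1)
    (j l : ℕ) (i i' : Fin 2) :
    cov[normalizedPair (ρ 1) Y j i, normalizedPair (ρ 1) Y l i'; P] ^ 2 =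
      lagSq ρ i i' ((l : ℤ) - j) := by
  have h1 := one_add_pmOne_mul_pos hr i
  have h2 := one_add_pmOne_mul_pos hr i'
  rw [hY.covariance_normalizedPair, div_pow, mul_pow, Real.sq_sqrt (by positivity),
    Real.sq_sqrt (by positivity), lagSq]
  congr 1
  ring

/-- The covariance of a sign change with the square of a component of a normalized pair: only the
quadratic component of the sign-change indicator contributes. -/
lemma covariance_signChange_sq (hY : IsStationaryGaussian Y ρ P) (hr : |ρ 1| < 1) (j l : ℕ)
    (i : Fin 2) :
    cov[signChange Y j, fun ω ↦ normalizedPair (ρ 1) Y l i ω ^ 2; P] =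
      coneConstant (√((1 - ρ 1) / (1 + ρ 1))) *
        (lagSq ρ 1 i ((l : ℤ) - j) - lagSq ρ 0 i ((l : ℤ) - j)) := by
  have := hY.isProbabilityMeasure
  set t := √((1 - ρ 1) / (1 + ρ 1)) with ht
  have ht0 : 0 < t := by
    have := abs_lt.1 hr
    exact Real.sqrt_pos.2 (div_pos (by linarith) (by linarith))
  set X := normalizedPair (ρ 1) Y with hX
  have hjoint : HasGaussianLaw (fun ω ↦ ((fun a ↦ X j a ω), X l i ω)) P := by
    exact (hY.hasGaussianLaw_normalizedPair (ρ 1) j l).map_fun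
      ((ContinuousLinearMap.fst ℝ (Fin 2 → ℝ) (Fin 2 → ℝ)).prod
        ((ContinuousLinearMap.proj i).comp (ContinuousLinearMap.snd ℝ (Fin 2 → ℝ) (Fin 2 → ℝ))))
  let F : (Fin 2 → ℝ) → ℝ := fun x ↦ (cone t).indicator (fun _ ↦ (1 : ℝ)) (x 0, x 1)
  have hF : Measurable F := (measurable_const.indicator (measurableSet_cone _)).comp (by fun_prop)
  have hFX : signChange Y j = fun ω ↦ F (fun a ↦ X j a ω) :=
    funext (signChange_eq_indicator_cone hr j)
  have h1 := covariance_sq_eq_covariance_projection_sq hjoint (hY.integral_normalizedPair _ j)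
    (hY.integral_normalizedPair _ l i) (fun a b h ↦ hY.covariance_normalizedPair_of_ne j h)
    (hY.covariance_normalizedPair_self hr j) hF (hFX ▸ hY.memLp_signChange hr j)
  rw [hFX, h1]
  simp only [Fin.sum_univ_two]
  have hpair : HasGaussianLaw (fun ω ↦ (X j 0 ω, X j 1 ω)) P := by
    exact hjoint.fst.map_fun ((ContinuousLinearMap.proj (R := ℝ) (φ := fun _ : Fin 2 ↦ ℝ) 0).prod
      (ContinuousLinearMap.proj 1))
  rw [← hY.covariance_normalizedPair_sq hr, ← hY.covariance_normalizedPair_sq hr]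
  exact covariance_cone_sq hpair (hY.integral_normalizedPair _ j 0)
    (hY.integral_normalizedPair _ j 1) (hY.covariance_normalizedPair_of_ne j (by decide))
    (hY.covariance_normalizedPair_self hr j 0) (hY.covariance_normalizedPair_self hr j 1) ht0 _ _

/-- The asymptotic variance of the number of sign changes is positive. The number of sign changes is
compared with a sum of quadratic functionals of the sequence, chosen parallel to the quadratic
component of the sign-change indicator: since the asymptotic covariance of the two is positive, the
asymptotic variance cannot vanish. -/
lemma pos_of_tendsto_variance (hY : IsStationaryGaussian Y ρ P) (hr : |ρ 1| < 1)
    (hρ : Summable fun k ↦ ρ k ^ 2) {L : ℝ}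
    (hL : Tendsto (fun n : ℕ ↦ (n : ℝ)⁻¹ *
      Var[fun ω ↦ ∑ k ∈ Finset.range n, signChange Y k ω; P]) atTop (𝓝 L)) : 0 < L := by
  have := hY.isProbabilityMeasure
  set X := normalizedPair (ρ 1) Y with hX
  set κ := coneConstant (√((1 - ρ 1) / (1 + ρ 1))) with hκ
  have hκ0 : 0 < κ := by
    have := abs_lt.1 hr
    exact coneConstant_pos (Real.sqrt_pos.2 (div_pos (by linarith) (by linarith)))
  set v := Var[fun x ↦ x ^ 2; gaussianReal 0 1] with hv
  let z : ℕ → Ω → ℝ := fun k ↦ (fun ω ↦ X k 1 ω ^ 2) - fun ω ↦ X k 0 ω ^ 2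
  have hX2 k i : MemLp (fun ω ↦ X k i ω ^ 2) 2 P :=
    memLp_two_sq_of_hasGaussianLaw (hY.hasGaussianLaw_normalizedPair_apply _ k i)
  have hz2 k : MemLp (z k) 2 P := (hX2 k 1).sub (hX2 k 0)
  have hC2 := hY.memLp_signChange hr
  have hCz (j l : ℕ) : cov[signChange Y j, z l; P] = κ * lagForm ρ ((l : ℤ) - j) := by
    rw [covariance_sub_right (hC2 j) (hX2 l 1) (hX2 l 0), hY.covariance_signChange_sq hr,
      hY.covariance_signChange_sq hr, lagForm]
    ring
  have hsq (j l : ℕ) (i i' : Fin 2) : cov[fun ω ↦ X j i ω ^ 2, fun ω ↦ X l i' ω ^ 2; P] =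
      v * lagSq ρ i i' ((l : ℤ) - j) := by
    rw [← hY.covariance_normalizedPair_sq hr]
    refine covariance_sq_sq ?_ (hY.integral_normalizedPair _ j i)
      (hY.integral_normalizedPair _ l i') (hY.covariance_normalizedPair_self hr j i)
    exact (hY.hasGaussianLaw_normalizedPair (ρ 1) j l).map_fun
      (((ContinuousLinearMap.proj i).comp (ContinuousLinearMap.fst ℝ (Fin 2 → ℝ) (Fin 2 → ℝ))).prod
        ((ContinuousLinearMap.proj i').comp
          (ContinuousLinearMap.snd ℝ (Fin 2 → ℝ) (Fin 2 → ℝ))))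
  have hzz (j l : ℕ) : cov[z j, z l; P] = v * lagForm ρ ((l : ℤ) - j) := by
    rw [covariance_sub_sub (hX2 j 1) (hX2 j 0) (hX2 l 1) (hX2 l 0), hsq, hsq, hsq, hsq, lagForm]
    ring
  have hsum := summable_lagForm hρ
  set e := ∑' k, lagForm ρ k with he
  have he0 : 0 < e := tsum_lagForm_pos hρ hY.variance_one hr
  have hT := tendsto_inv_mul_sum_range_sum_range_sub hsum
  have hquad (t : ℝ) : 0 ≤ L + 2 * t * (κ * e) + t ^ 2 * (v * e) := by
    have hlim := (hL.add ((hT.const_mul κ).const_mul (2 * t))).add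
      ((hT.const_mul v).const_mul (t ^ 2))
    refine ge_of_tendsto' hlim fun n ↦ ?_
    set S : Ω → ℝ := fun ω ↦ ∑ k ∈ Finset.range n, signChange Y k ω with hS
    set Z : Ω → ℝ := fun ω ↦ ∑ k ∈ Finset.range n, z k ω with hZ
    have hS2 : MemLp S 2 P := memLp_finsetSum _ fun k _ ↦ hC2 k
    have hZ2 : MemLp Z 2 P := memLp_finsetSum _ fun k _ ↦ hz2 k
    have hSZ : cov[S, Z; P] =
        ∑ j ∈ Finset.range n, ∑ l ∈ Finset.range n, κ * lagForm ρ ((l : ℤ) - j) := by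
      rw [covariance_fun_sum_fun_sum' (fun k _ ↦ hC2 k) (fun k _ ↦ hz2 k)]
      simp_rw [hCz]
    have hZZ : cov[Z, Z; P] =
        ∑ j ∈ Finset.range n, ∑ l ∈ Finset.range n, v * lagForm ρ ((l : ℤ) - j) := by
      rw [covariance_fun_sum_fun_sum' (fun k _ ↦ hz2 k) (fun k _ ↦ hz2 k)]
      simp_rw [hzz]
    have hvar : 0 ≤ Var[S + t • Z; P] := variance_nonneg _ _
    rw [← covariance_self (hS2.add (hZ2.const_smul t)).aemeasurable,
      covariance_add_left hS2 (hZ2.const_smul t) (hS2.add (hZ2.const_smul t)),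
      covariance_add_right hS2 hS2 (hZ2.const_smul t),
      covariance_add_right (hZ2.const_smul t) hS2 (hZ2.const_smul t), covariance_smul_right,
      covariance_smul_left, covariance_smul_left, covariance_smul_right, covariance_comm Z S, hSZ,
      hZZ, covariance_self hS2.aemeasurable] at hvar
    simp_rw [← Finset.mul_sum] at hvar
    have hn : (0 : ℝ) ≤ (n : ℝ)⁻¹ := by positivity
    have := mul_nonneg hn hvar
    refine this.trans (le_of_eq ?_)
    ring
  by_contra hcon
  have hv0 : 0 ≤ v := variance_nonneg _ _
  -- the quadratic polynomial `hquad` is negative at this small negative argument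
  have h1 := hquad (-(κ / (v + 1)))
  have h2 : 0 < v + 1 := by linarith
  have h3 : L + 2 * -(κ / (v + 1)) * (κ * e) + (-(κ / (v + 1))) ^ 2 * (v * e) =
      L - κ ^ 2 * e * (v + 2) / (v + 1) ^ 2 := by
    field_simp; ring
  rw [h3] at h1
  have h4 : 0 < κ ^ 2 * e * (v + 2) / (v + 1) ^ 2 := by positivity
  linarith

end IsStationaryGaussian

end Positivity

/-! ### Continuity of orthant-type probabilities in the covariances -/

section WeakConvergence

variable {Ω ι : Type*} [MeasurableSpace Ω] [Fintype ι]

lemma charFun_map_toLp_of_mean_zero {Q : Measure Ω} {X : ι → Ω → ℝ}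
    (hQ : HasGaussianLaw (fun ω i ↦ X i ω) Q) (hm : ∀ i, ∫ ω, X i ω ∂Q = 0)
    (t : EuclideanSpace ℝ ι) :
    charFun (Q.map fun ω ↦ WithLp.toLp 2 fun i ↦ X i ω) t =
      Complex.exp (-((∑ i, ∑ j, t i * (t j * cov[X i, X j; Q]) : ℝ) : ℂ) / 2) := by
  have := hQ.isProbabilityMeasure
  have hXi i : HasGaussianLaw (X i) Q := hQ.eval i
  rw [(hQ.toLp_pi 2).charFun_map_eq]
  have hinner : (fun ω ↦ inner ℝ t (WithLp.toLp 2 fun i ↦ X i ω)) =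
      fun ω ↦ ∑ i, t i * X i ω := by
    ext ω
    simp [PiLp.inner_apply, mul_comm]
  have h2 i : MemLp (fun ω ↦ t i * X i ω) 2 Q := (hXi i).memLp_two.const_mul _
  have hmean : ∫ ω, ∑ i, t i * X i ω ∂Q = 0 := by
    rw [integral_finsetSum _ fun i _ ↦ (hXi i).integrable.const_mul _]
    simp [integral_const_mul, hm]
  have hvar : Var[fun ω ↦ ∑ i, t i * X i ω; Q] = ∑ i, ∑ j, t i * (t j * cov[X i, X j; Q]) := by
    rw [← covariance_self (memLp_finsetSum _ fun i _ ↦ h2 i).aemeasurable,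
      covariance_fun_sum_fun_sum h2 h2]
    simp_rw [covariance_const_mul_left, covariance_const_mul_right]
  rw [hinner, hmean, hvar]
  simp [neg_div]

/-- If the covariances of centred Gaussian vectors converge to those of a vector none of whose
coordinates is degenerate, then the probabilities of an open set whose boundary is contained in the
coordinate hyperplanes converge. -/
lemma tendsto_measureReal_of_tendsto_covariance {Q : ℕ → Measure Ω} {Q' : Measure Ω}
    {X : ι → Ω → ℝ} (hQ : ∀ n, HasGaussianLaw (fun ω i ↦ X i ω) (Q n))
    (hQ' : HasGaussianLaw (fun ω i ↦ X i ω) Q') (hm : ∀ n i, ∫ ω, X i ω ∂(Q n) = 0)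
    (hm' : ∀ i, ∫ ω, X i ω ∂Q' = 0)
    (hcov : ∀ i j, Tendsto (fun n ↦ cov[X i, X j; Q n]) atTop (𝓝 cov[X i, X j; Q']))
    (hvar : ∀ i, Var[X i; Q'] ≠ 0) {A K : Set (ι → ℝ)} (hA : IsOpen A) (hK : IsClosed K)
    (hAK : A ⊆ K) (hbdry : ∀ x ∈ K, x ∉ A → ∃ i, x i = 0) :
    Tendsto (fun n ↦ (Q n).real {ω | (fun i ↦ X i ω) ∈ A}) atTop
      (𝓝 (Q'.real {ω | (fun i ↦ X i ω) ∈ A})) := by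
  have hpn n := (hQ n).isProbabilityMeasure
  have hp' := hQ'.isProbabilityMeasure
  let Z : Ω → EuclideanSpace ℝ ι := fun ω ↦ WithLp.toLp 2 fun i ↦ X i ω
  have hZ n : AEMeasurable Z (Q n) := ((hQ n).toLp_pi 2).aemeasurable
  have hZ' : AEMeasurable Z Q' := (hQ'.toLp_pi 2).aemeasurable
  let μ (n : ℕ) : ProbabilityMeasure (EuclideanSpace ℝ ι) :=
    ⟨(Q n).map Z, Measure.isProbabilityMeasure_map (hZ n)⟩
  let μ' : ProbabilityMeasure (EuclideanSpace ℝ ι) :=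
    ⟨Q'.map Z, Measure.isProbabilityMeasure_map hZ'⟩
  have hlim : Tendsto μ atTop (𝓝 μ') := by
    refine ProbabilityMeasure.tendsto_of_tendsto_charFun fun t ↦ ?_
    change Tendsto (fun n ↦ charFun ((Q n).map Z) t) atTop (𝓝 (charFun (Q'.map Z) t))
    simp_rw [Z, charFun_map_toLp_of_mean_zero (hQ _) (hm _),
      charFun_map_toLp_of_mean_zero hQ' hm']
    refine (Complex.continuous_exp.tendsto _).comp (Tendsto.div_const (Tendsto.neg ?_) _)
    refine (Complex.continuous_ofReal.tendsto _).comp ?_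
    exact tendsto_finsetSum _ fun i _ ↦ tendsto_finsetSum _ fun j _ ↦
      ((hcov i j).const_mul _).const_mul _
  let A' : Set (EuclideanSpace ℝ ι) := WithLp.ofLp ⁻¹' A
  have hofLp : Continuous (WithLp.ofLp : EuclideanSpace ℝ ι → ι → ℝ) := PiLp.continuous_ofLp 2 _
  have hA' : IsOpen A' := hA.preimage hofLp
  have hfr : frontier A' ⊆ ⋃ i, {x : EuclideanSpace ℝ ι | x i = 0} := by
    intro x hx
    rw [hA'.frontier_eq] at hx
    have hxK : x ∈ WithLp.ofLp ⁻¹' K :=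
      closure_minimal (Set.preimage_mono hAK) (hK.preimage hofLp) hx.1
    obtain ⟨i, hi⟩ := hbdry _ hxK hx.2
    exact Set.mem_iUnion.2 ⟨i, hi⟩
  have hnull : (μ' : Measure (EuclideanSpace ℝ ι)) (frontier A') = 0 := by
    refine measure_mono_null hfr (measure_iUnion_null fun i ↦ ?_)
    change (Q'.map Z) {x | x i = 0} = 0
    have hcl : MeasurableSet {x : EuclideanSpace ℝ ι | x i = 0} :=
      measurableSet_eq_fun (by fun_prop) measurable_const
    rw [Measure.map_apply_of_aemeasurable hZ' hcl]
    have hXi : HasGaussianLaw (X i) Q' := hQ'.eval i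
    have hna := nullSingletonClass_gaussianReal (μ := ∫ ω, X i ω ∂Q')
      (v := Var[X i; Q'].toNNReal) (by
        rw [ne_eq, Real.toNNReal_eq_zero, not_le]
        exact lt_of_le_of_ne (variance_nonneg _ _) (hvar i).symm)
    have h0 := measure_singleton (μ := gaussianReal (∫ ω, X i ω ∂Q') Var[X i; Q'].toNNReal) 0
    rw [← hXi.map_eq_gaussianReal,
      Measure.map_apply_of_aemeasurable hXi.aemeasurable (measurableSet_singleton 0)] at h0
    exact h0
  have h := ProbabilityMeasure.tendsto_measure_of_null_frontier_of_tendsto' hlim hnull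
  have h2 := (ENNReal.tendsto_toReal (measure_ne_top (μ' : Measure _) A')).comp h
  have e (R : Measure Ω) (hR : AEMeasurable Z R) :
      ((R.map Z) A').toReal = R.real {ω | (fun i ↦ X i ω) ∈ A} := by
    rw [Measure.map_apply_of_aemeasurable hR hA'.measurableSet]
    rfl
  have e2 : ((μ' : Measure (EuclideanSpace ℝ ι)) A').toReal =
      Q'.real {ω | (fun i ↦ X i ω) ∈ A} := e Q' hZ'
  rw [e2] at h2
  exact h2.congr fun n ↦ e (Q n) (hZ n)

end WeakConvergence

section SignChangeContinuity

namespace IsStationaryGaussian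

variable {Ω : Type*} [MeasurableSpace Ω] {Y : ℕ → Ω → ℝ}

lemma covariance_signChange_eq_measureReal {P : Measure Ω} {ρ : ℤ → ℝ}
    (hY : IsStationaryGaussian Y ρ P) (hr : |ρ 1| < 1) (k : ℕ) :
    cov[signChange Y 0, signChange Y k; P] =
      P.real {ω | Y 0 ω * Y 1 ω < 0 ∧ Y k ω * Y (k + 1) ω < 0} -
        P.real {ω | Y 0 ω * Y 1 ω < 0} * P.real {ω | Y k ω * Y (k + 1) ω < 0} := by
  have := hY.isProbabilityMeasure
  have hmeas (k : ℕ) : NullMeasurableSet {ω | Y k ω * Y (k + 1) ω < 0} P :=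
    nullMeasurableSet_lt ((hY.hasGaussianLaw k).aemeasurable.mul
      (hY.hasGaussianLaw (k + 1)).aemeasurable) aemeasurable_const
  have hint (S : Set Ω) (hS : NullMeasurableSet S P) :
      ∫ ω, S.indicator (fun _ ↦ (1 : ℝ)) ω ∂P = P.real S := by
    rw [integral_indicator₀ hS]
    simp
  rw [covariance_eq_sub (hY.memLp_signChange hr 0) (hY.memLp_signChange hr k)]
  congr 1
  · refine Eq.trans ?_ (hint _ ((hmeas 0).inter (hmeas k)))
    congr 1
    ext ω
    by_cases h1 : Y 0 ω * Y 1 ω < 0 <;> by_cases h2 : Y k ω * Y (k + 1) ω < 0 <;>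
      simp [signChange, Set.indicator, h1, h2]
  · exact congrArg₂ (· * ·) (hint _ (hmeas 0)) (hint _ (hmeas k))

/-- The covariances of sign changes depend continuously on the autocovariance function. -/
lemma tendsto_covariance_signChange {Q : ℕ → Measure Ω} {Q' : Measure Ω} {ρ : ℕ → ℤ → ℝ}
    {ρ' : ℤ → ℝ} (hQ : ∀ n, IsStationaryGaussian Y (ρ n) (Q n)) (hr : ∀ n, |ρ n 1| < 1)
    (hQ' : IsStationaryGaussian Y ρ' Q') (hr' : |ρ' 1| < 1)
    (h : ∀ k, Tendsto (fun n ↦ ρ n k) atTop (𝓝 (ρ' k))) (k : ℕ) :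
    Tendsto (fun n ↦ cov[signChange Y 0, signChange Y k; Q n]) atTop
      (𝓝 cov[signChange Y 0, signChange Y k; Q']) := by
  rw [hQ'.covariance_signChange_eq_measureReal hr']
  simp_rw [fun n ↦ (hQ n).covariance_signChange_eq_measureReal (hr n)]
  let f : Fin 4 → ℕ := ![0, 1, k, k + 1]
  have key {A K : Set (Fin 4 → ℝ)} (hA : IsOpen A) (hK : IsClosed K)
      (hAK : A ⊆ K) (hbdry : ∀ x ∈ K, x ∉ A → ∃ i, x i = 0) :
      Tendsto (fun n ↦ (Q n).real {ω | (fun i ↦ Y (f i) ω) ∈ A}) atTop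
        (𝓝 (Q'.real {ω | (fun i ↦ Y (f i) ω) ∈ A})) := by
    refine tendsto_measureReal_of_tendsto_covariance (X := fun i ↦ Y (f i))
      (fun n ↦ hasGaussianLaw_comp (hQ n).gaussian f) (hasGaussianLaw_comp hQ'.gaussian f)
      (fun n i ↦ (hQ n).mean_zero _) (fun i ↦ hQ'.mean_zero _) (fun i j ↦ ?_) (fun i ↦ ?_)
      hA hK hAK hbdry
    · rw [hQ'.covariance]
      simp_rw [fun n ↦ (hQ n).covariance]
      exact h _
    · rw [← covariance_self (hQ'.hasGaussianLaw _).aemeasurable, hQ'.covariance, sub_self,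
        hQ'.variance_one]
      exact one_ne_zero
  have hzero {x : Fin 4 → ℝ} {a b : Fin 4} (h1 : x a * x b ≤ 0) (h2 : ¬ x a * x b < 0) :
      ∃ i, x i = 0 := by
    rcases mul_eq_zero.1 (le_antisymm h1 (not_lt.1 h2)) with h3 | h3
    exacts [⟨a, h3⟩, ⟨b, h3⟩]
  have hpair (a b : Fin 4) := key (A := {x | x a * x b < 0}) (K := {x | x a * x b ≤ 0})
    (isOpen_lt (by fun_prop) continuous_const) (isClosed_le (by fun_prop) continuous_const)
    (fun x hx ↦ (show x a * x b < 0 from hx).le) (fun x h1 h2 ↦ hzero h1 h2)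
  have hboth := key (A := {x | x 0 * x 1 < 0} ∩ {x | x 2 * x 3 < 0})
    (K := {x | x 0 * x 1 ≤ 0} ∩ {x | x 2 * x 3 ≤ 0})
    ((isOpen_lt (by fun_prop) continuous_const).inter (isOpen_lt (by fun_prop) continuous_const))
    ((isClosed_le (by fun_prop) continuous_const).inter
      (isClosed_le (by fun_prop) continuous_const))
    (fun x hx ↦ ⟨(show x 0 * x 1 < 0 from hx.1).le, (show x 2 * x 3 < 0 from hx.2).le⟩) (fun x h1 h2 ↦ by
      by_cases h3 : x 0 * x 1 < 0
      · exact hzero h1.2 fun h4 ↦ h2 ⟨h3, h4⟩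
      · exact hzero h1.1 h3)
  exact hboth.sub ((hpair 0 1).mul (hpair 2 3))

end IsStationaryGaussian

end SignChangeContinuity

/-! ### Fractional Gaussian noise -/

section FractionalGaussianNoise

/-- The autocovariance function of the increments of standard fractional Brownian motion with Hurst
parameter `H`. -/
noncomputable def fgnCov (H : ℝ) (k : ℤ) : ℝ :=
  1 / 2 * (|(k : ℝ) + 1| ^ (2 * H) + |(k : ℝ) - 1| ^ (2 * H) - 2 * |(k : ℝ)| ^ (2 * H))

lemma fgnCov_zero {H : ℝ} (hH : 0 < H) : fgnCov H 0 = 1 := by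
  have : (2 * H) ≠ 0 := by positivity
  simp [fgnCov, Real.zero_rpow this]
  norm_num

lemma fgnCov_neg (H : ℝ) (k : ℤ) : fgnCov H (-k) = fgnCov H k := by
  have h1 : |-(k : ℝ) + 1| = |(k : ℝ) - 1| := by rw [← abs_neg]; congr 1; ring
  have h2 : |-(k : ℝ) - 1| = |(k : ℝ) + 1| := by rw [← abs_neg]; congr 1; ring
  simp only [fgnCov, Int.cast_neg, abs_neg, h1, h2]
  ring

lemma abs_fgnCov_one_le {H : ℝ} (hH : H ∈ Set.Ioo (0 : ℝ) (3 / 4)) : |fgnCov H 1| ≤ 1 / 2 := by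
  have h0 : (2 * H) ≠ 0 := by have := hH.1; positivity
  have h1 : (1 : ℝ) ≤ 2 ^ (2 * H) := Real.one_le_rpow (by norm_num) (by linarith [hH.1])
  have h2 : (2 : ℝ) ^ (2 * H) ≤ 3 := by
    have h3 : (2 : ℝ) ^ (2 * H) ≤ 2 ^ (3 / 2 : ℝ) :=
      Real.rpow_le_rpow_of_exponent_le (by norm_num) (by linarith [hH.2])
    refine h3.trans ?_
    have h4 : ((2 : ℝ) ^ (3 / 2 : ℝ)) ^ 2 = 8 := by
      rw [← Real.rpow_natCast, ← Real.rpow_mul (by norm_num)]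
      norm_num
    nlinarith [Real.rpow_nonneg (zero_le_two (α := ℝ)) (3 / 2)]
  have e : fgnCov H 1 = 1 / 2 * (2 ^ (2 * H) - 2) := by
    simp only [fgnCov, Int.cast_one, sub_self, abs_zero, Real.zero_rpow h0, abs_one, Real.one_rpow]
    norm_num
  rw [e, abs_le]
  constructor <;> linarith

lemma continuousOn_fgnCov (k : ℤ) : ContinuousOn (fun H ↦ fgnCov H k) (Set.Ioi 0) := by
  have h (a : ℝ) : ContinuousOn (fun H : ℝ ↦ |a| ^ (2 * H)) (Set.Ioi 0) := by
    by_cases ha : a = 0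
    · refine (continuousOn_const (c := (0 : ℝ))).congr fun H hH ↦ ?_
      have : (2 * H) ≠ 0 := (mul_pos two_pos hH).ne'
      simp [ha, Real.zero_rpow this]
    · exact (Continuous.rpow continuous_const (by fun_prop) fun _ ↦
        Or.inl (abs_ne_zero.2 ha)).continuousOn
  exact continuousOn_const.mul (((h _).add (h _)).sub (continuousOn_const.mul (h _)))

/-- A second difference of `x ↦ x ^ p` is bounded by the second derivative. -/
lemma abs_rpow_second_difference_le {p x : ℝ} (hp0 : 0 < p) (hp : p < 3 / 2) (hx : 2 ≤ x) :
    |(x + 1) ^ p + (x - 1) ^ p - 2 * x ^ p| ≤ 2 * (x - 1) ^ (p - 2) := by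
  have hx1 : 0 < x - 1 := by linarith
  set M := (x - 1) ^ (p - 2) with hM
  have hM0 : 0 ≤ M := Real.rpow_nonneg hx1.le _
  -- first-order bound for `y ↦ y ^ (p - 1)`
  have hfirst (y : ℝ) (hy : x - 1 ≤ y) : |(y + 1) ^ (p - 1) - y ^ (p - 1)| ≤ |p - 1| * M := by
    have h := Convex.norm_image_sub_le_of_norm_hasDerivWithin_le (f := fun u : ℝ ↦ u ^ (p - 1))
      (f' := fun u ↦ (p - 1) * u ^ (p - 1 - 1)) (C := |p - 1| * M) (s := Set.Ici (x - 1))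
      (x := y) (y := y + 1)
      (fun u hu ↦ (Real.hasDerivAt_rpow_const
        (Or.inl (hx1.trans_le hu).ne')).hasDerivWithinAt)
      (fun u hu ↦ by
        rw [norm_mul, Real.norm_eq_abs, Real.norm_eq_abs,
          abs_of_nonneg (Real.rpow_nonneg (hx1.le.trans hu) _)]
        gcongr
        rw [show p - 1 - 1 = p - 2 by ring]
        exact Real.rpow_le_rpow_of_nonpos hx1 hu (by linarith))
      (convex_Ici _) hy (by simp only [Set.mem_Ici]; linarith)
    simpa using h
  have h := Convex.norm_image_sub_le_of_norm_hasDerivWithin_le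
    (f := fun u : ℝ ↦ (u + 1) ^ p - u ^ p)
    (f' := fun u ↦ p * (u + 1) ^ (p - 1) - p * u ^ (p - 1)) (C := p * (|p - 1| * M))
    (s := Set.Ici (x - 1)) (x := x - 1) (y := x)
    (fun u hu ↦ by
      have hu0 : 0 < u := hx1.trans_le hu
      have h1 : HasDerivAt (fun u : ℝ ↦ (u + 1) ^ p) (p * (u + 1) ^ (p - 1)) u := by
        simpa using (Real.hasDerivAt_rpow_const (x := u + 1) (p := p)
          (Or.inl (by linarith : u + 1 ≠ 0))).comp_add_const u 1
      exact (h1.sub (Real.hasDerivAt_rpow_const (Or.inl hu0.ne'))).hasDerivWithinAt)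
    (fun u hu ↦ by
      rw [← mul_sub, norm_mul, Real.norm_eq_abs, Real.norm_eq_abs, abs_of_pos hp0]
      gcongr
      exact hfirst u hu)
    (convex_Ici _) (by simp) (by simp only [Set.mem_Ici]; linarith)
  have e : ((x + 1) ^ p - x ^ p) - ((x - 1 + 1) ^ p - (x - 1) ^ p) =
      (x + 1) ^ p + (x - 1) ^ p - 2 * x ^ p := by
    rw [sub_add_cancel]; ring
  simp only [e, sub_sub_cancel, norm_one, mul_one] at h
  rw [Real.norm_eq_abs] at h
  refine h.trans ?_
  rw [← mul_assoc]
  gcongr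
  have : |p - 1| ≤ 1 := by rw [abs_le]; constructor <;> linarith
  nlinarith [abs_nonneg (p - 1)]

lemma abs_fgnCov_le {H : ℝ} (hH : H ∈ Set.Ioo (0 : ℝ) (3 / 4)) {k : ℤ} (hk : k ≠ 0) :
    |fgnCov H k| ≤ 4 * |(k : ℝ)| ^ (2 * H - 2) := by
  have hnat (n : ℕ) (hn : n ≠ 0) : |fgnCov H n| ≤ 4 * |((n : ℤ) : ℝ)| ^ (2 * H - 2) := by
    rcases Nat.lt_or_ge n 2 with h1 | h2
    · obtain rfl : n = 1 := by omega
      have := abs_fgnCov_one_le hH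
      simp only [Nat.cast_one, Int.cast_one, abs_one, Real.one_rpow]
      linarith
    · have hx : (2 : ℝ) ≤ n := by exact_mod_cast h2
      have h := abs_rpow_second_difference_le (p := 2 * H) (by linarith [hH.1])
        (by linarith [hH.2]) hx
      simp only [fgnCov, Int.cast_natCast, abs_mul]
      rw [abs_of_nonneg (by linarith : (0 : ℝ) ≤ (n : ℝ) + 1),
        abs_of_nonneg (by linarith : (0 : ℝ) ≤ (n : ℝ) - 1),
        abs_of_nonneg (by linarith : (0 : ℝ) ≤ (n : ℝ)), abs_of_pos (by norm_num : (0 : ℝ) < 1 / 2)]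
      have hhalf : ((n : ℝ) - 1) ^ (2 * H - 2) ≤ ((n : ℝ) / 2) ^ (2 * H - 2) :=
        Real.rpow_le_rpow_of_nonpos (by linarith) (by linarith) (by linarith [hH.2])
      have h4 : ((2 : ℝ)⁻¹) ^ (2 * H - 2) ≤ 4 := by
        rw [Real.inv_rpow (by norm_num), ← Real.rpow_neg (by norm_num)]
        calc (2 : ℝ) ^ (-(2 * H - 2)) ≤ 2 ^ (2 : ℝ) :=
              Real.rpow_le_rpow_of_exponent_le (by norm_num) (by linarith [hH.1])
          _ = 4 := by norm_num
      rw [div_eq_mul_inv, Real.mul_rpow (by linarith) (by norm_num)] at hhalf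
      have hn0 : 0 ≤ (n : ℝ) ^ (2 * H - 2) := Real.rpow_nonneg (by linarith) _
      nlinarith [mul_le_mul_of_nonneg_left h4 hn0]
  rcases Int.natAbs_eq k with h | h
  · rw [h]; exact hnat _ (Int.natAbs_ne_zero.2 hk)
  · rw [h, fgnCov_neg, Int.cast_neg, abs_neg]; exact hnat _ (Int.natAbs_ne_zero.2 hk)

/-- A bound for the squared autocovariances that is uniform in the Hurst parameters up to `h`. The
second summand takes care of lag zero, where the first one vanishes by the convention for powers of
zero. -/
noncomputable def fgnSqBound (h : ℝ) (k : ℤ) : ℝ :=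
  16 * |(k : ℝ)| ^ (-(4 - 4 * h)) + if k = 0 then 1 else 0

lemma fgnCov_sq_le {H h : ℝ} (hH : H ∈ Set.Ioo (0 : ℝ) (3 / 4)) (hh : H ≤ h) (k : ℤ) :
    fgnCov H k ^ 2 ≤ fgnSqBound h k := by
  by_cases hk : k = 0
  · rw [hk, fgnCov_zero hH.1, fgnSqBound, if_pos rfl, one_pow]
    have : 0 ≤ 16 * |((0 : ℤ) : ℝ)| ^ (-(4 - 4 * h)) := by positivity
    linarith
  · have h1 := abs_fgnCov_le hH hk
    have hk1 : 1 ≤ |(k : ℝ)| := by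
      rw [← Int.cast_abs]; exact_mod_cast Int.one_le_abs hk
    rw [fgnSqBound, if_neg hk, add_zero, ← sq_abs]
    calc |fgnCov H k| ^ 2 ≤ (4 * |(k : ℝ)| ^ (2 * H - 2)) ^ 2 := by gcongr
      _ = 16 * |(k : ℝ)| ^ ((2 * H - 2) * (2 : ℕ)) := by
        rw [mul_pow, Real.rpow_mul_natCast (abs_nonneg _)]; norm_num
      _ ≤ 16 * |(k : ℝ)| ^ (-(4 - 4 * h)) := by
        gcongr
        push_cast
        linarith

lemma summable_fgnSqBound {h : ℝ} (hh : h < 3 / 4) : Summable (fgnSqBound h) :=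
  ((Real.summable_abs_int_rpow (by linarith)).mul_left 16).add (hasSum_ite_eq 0 1).summable

lemma summable_fgnCov_sq {H : ℝ} (hH : H ∈ Set.Ioo (0 : ℝ) (3 / 4)) :
    Summable fun k ↦ fgnCov H k ^ 2 :=
  Summable.of_nonneg_of_le (fun _ ↦ sq_nonneg _) (fgnCov_sq_le hH le_rfl)
    (summable_fgnSqBound hH.2)

variable {Ω : Type*} [MeasurableSpace Ω]

/-- The increments of a sequence of random variables. -/
def increment (X : ℕ → Ω → ℝ) (k : ℕ) (ω : Ω) : ℝ := X (k + 1) ω - X k ω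

/-- The increments of standard fractional Brownian motion form a stationary Gaussian sequence. -/
lemma isStationaryGaussian_increment {H : ℝ} {B : ℝ≥0 → Ω → ℝ} {P : Measure Ω}
    (hB : IsFBM H B P) (h1 : Var[B 1; P] = 1) :
    IsStationaryGaussian (increment (discretization B)) (fgnCov H) P where
  gaussian := by
    classical
    refine hB.gaussian.of_isGaussianProcess fun k ↦ ?_
    let I : Finset ℝ≥0 := {((k + 1 : ℕ) : ℝ≥0), (k : ℝ≥0)}
    let L : (I → ℝ) →L[ℝ] ℝ :=
      ContinuousLinearMap.proj (R := ℝ) (φ := fun _ : I ↦ ℝ) ⟨((k + 1 : ℕ) : ℝ≥0), by simp [I]⟩ -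
        ContinuousLinearMap.proj (R := ℝ) (φ := fun _ : I ↦ ℝ) ⟨(k : ℝ≥0), by simp [I]⟩
    exact ⟨I, L, fun ω ↦ rfl⟩
  mean_zero k := by
    have hI t : Integrable (B t) P := (hB.gaussian.hasGaussianLaw_eval t).integrable
    simp only [increment, discretization]
    rw [integral_sub (hI _) (hI _), hB.mean_zero, hB.mean_zero, sub_zero]
  covariance j l := by
    have := hB.gaussian.isProbabilityMeasure
    have h2 t : MemLp (B t) 2 P := (hB.gaussian.hasGaussianLaw_eval t).memLp_two
    have e k : increment (discretization B) k = B ((k + 1 : ℕ) : ℝ≥0) - B (k : ℝ≥0) := rfl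
    rw [e, e, covariance_sub_sub (h2 _) (h2 _) (h2 _) (h2 _), hB.covariance, hB.covariance,
      hB.covariance, hB.covariance, h1]
    simp only [fgnCov, NNReal.coe_natCast, Nat.cast_add, Nat.cast_one, NNReal.coe_add,
      NNReal.coe_one, Int.cast_sub,
      Int.cast_natCast]
    rw [show |(j : ℝ) + 1 - (l + 1)| = |(l : ℝ) - j| by rw [abs_sub_comm]; congr 1; ring,
      show |(j : ℝ) + 1 - l| = |(l : ℝ) - j - 1| by rw [abs_sub_comm]; congr 1; ring,
      show |(j : ℝ) - (l + 1)| = |(l : ℝ) - j + 1| by rw [abs_sub_comm]; congr 1; ring,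
      abs_sub_comm (j : ℝ) l]
    ring
  variance_one := fgnCov_zero hB.hurst_mem.1

/-- Ties have probability zero, so that a change of direction is almost surely the same as a sign
change of the increments. -/
lemma changeIndicator_ae_eq_signChange {X : ℕ → Ω → ℝ} {ρ : ℤ → ℝ} {P : Measure Ω}
    (hY : IsStationaryGaussian (increment X) ρ P) (k : ℕ) :
    changeIndicator X k =ᵐ[P] signChange (increment X) k := by
  have hne (k : ℕ) : ∀ᵐ ω ∂P, increment X k ω ≠ 0 := by
    have hG := hY.hasGaussianLaw k
    have hna := nullSingletonClass_gaussianReal (μ := 0) (v := 1) one_ne_zero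
    have h0 := measure_singleton (μ := gaussianReal 0 1) 0
    have hlaw : P.map (increment X k) = gaussianReal 0 1 := by
      rw [hG.map_eq_gaussianReal, hY.mean_zero, ← covariance_self hG.aemeasurable, hY.covariance,
        sub_self, hY.variance_one, Real.toNNReal_one]
    rw [← hlaw, Measure.map_apply_of_aemeasurable hG.aemeasurable (measurableSet_singleton 0)] at h0
    rw [ae_iff]
    simp only [ne_eq, not_not]
    exact h0
  filter_upwards [hne k, hne (k + 1)] with ω h1 h2
  simp only [increment] at h1 h2
  simp only [changeIndicator, signChange, increment, Set.indicator, Set.mem_ofPred_eq]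
  have e1 : (X k ω ≥ X (k + 1) ω ∧ X (k + 1) ω < X (k + 2) ω) ↔
      (X (k + 1) ω - X k ω < 0 ∧ 0 < X (k + 1 + 1) ω - X (k + 1) ω) := by
    constructor
    · rintro ⟨h3, h4⟩
      exact ⟨lt_of_le_of_ne (by linarith) h1, by linarith⟩
    · rintro ⟨h3, h4⟩
      exact ⟨by linarith, by linarith⟩
  have e2 : (X k ω < X (k + 1) ω ∧ X (k + 1) ω ≥ X (k + 2) ω) ↔
      (0 < X (k + 1) ω - X k ω ∧ X (k + 1 + 1) ω - X (k + 1) ω < 0) := by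
    constructor
    · rintro ⟨h3, h4⟩
      exact ⟨by linarith, lt_of_le_of_ne (by linarith) h2⟩
    · rintro ⟨h3, h4⟩
      exact ⟨by linarith, by linarith⟩
  simp only [e1, e2, mul_neg_iff]
  by_cases a : X (k + 1) ω - X k ω < 0
  · have a' : ¬ 0 < X (k + 1) ω - X k ω := by linarith
    simp [a, a']
  · have a' : 0 < X (k + 1) ω - X k ω := lt_of_le_of_ne (not_lt.1 a) (Ne.symm h1)
    simp [a, a']

end FractionalGaussianNoise

/-! ### The asymptotic variance -/

section AsymptoticVariance

variable {Ω : Type*} [MeasurableSpace Ω] {P : ℝ → Measure Ω}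

/-- The covariance, under `P H`, of the sign changes of a stationary sequence `Y` at lag `k`. -/
noncomputable def signChangeCov (Y : ℕ → Ω → ℝ) (P : ℝ → Measure Ω) (H : ℝ) (k : ℤ) : ℝ :=
  cov[signChange Y 0, signChange Y k.natAbs; P H]

/-- A bound for the covariances of sign changes that is uniform in the Hurst parameters up to
`h`. -/
noncomputable def signChangeBound (h : ℝ) (k : ℤ) : ℝ :=
  1600 * (fgnSqBound h (k - 1) + fgnSqBound h k + fgnSqBound h (k + 1))

lemma summable_signChangeBound {h : ℝ} (hh : h < 3 / 4) : Summable (signChangeBound h) := by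
  have hs := summable_fgnSqBound hh
  have h1 : Summable fun k : ℤ ↦ fgnSqBound h (k - 1) :=
    ((Equiv.subRight (1 : ℤ)).summable_iff (f := fgnSqBound h)).2 hs
  have h2 : Summable fun k : ℤ ↦ fgnSqBound h (k + 1) :=
    ((Equiv.addRight (1 : ℤ)).summable_iff (f := fgnSqBound h)).2 hs
  exact ((h1.add hs).add h2).mul_left _

lemma abs_signChangeCov_le {Y : ℕ → Ω → ℝ} {H h : ℝ}
    (hY : IsStationaryGaussian Y (fgnCov H) (P H)) (hH : H ∈ Set.Ioo (0 : ℝ) (3 / 4))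
    (hh : H ≤ h) (k : ℤ) : |signChangeCov Y P H k| ≤ signChangeBound h k := by
  have hk : ((k.toNat : ℤ) - ((-k).toNat : ℤ)) = k := by omega
  have h1 := hY.abs_covariance_signChange_le (abs_fgnCov_one_le hH) (-k).toNat k.toNat
  rw [hY.covariance_signChange_eq, hk] at h1
  refine h1.trans ?_
  rw [signChangeBound]
  gcongr <;> exact fgnCov_sq_le hH hh _

lemma variance_sum_signChange {Y : ℕ → Ω → ℝ} {H : ℝ}
    (hY : IsStationaryGaussian Y (fgnCov H) (P H)) (hH : H ∈ Set.Ioo (0 : ℝ) (3 / 4)) (n : ℕ) :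
    Var[fun ω ↦ ∑ k ∈ Finset.range n, signChange Y k ω; P H] =
      ∑ j ∈ Finset.range n, ∑ l ∈ Finset.range n, signChangeCov Y P H ((l : ℤ) - j) := by
  have := hY.isProbabilityMeasure
  have hr : |fgnCov H 1| < 1 := (abs_fgnCov_one_le hH).trans_lt (by norm_num)
  have h2 k : MemLp (fun ω ↦ signChange Y k ω) 2 (P H) := hY.memLp_signChange hr k
  rw [← covariance_self (memLp_finsetSum _ fun k _ ↦ h2 k).aemeasurable,
    covariance_fun_sum_fun_sum' (fun k _ ↦ h2 k) (fun k _ ↦ h2 k)]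
  exact Finset.sum_congr rfl fun j _ ↦ Finset.sum_congr rfl fun l _ ↦
    hY.covariance_signChange_eq j l

lemma scaledVariance_eq_inv_mul_variance {B : ℝ≥0 → Ω → ℝ} {H : ℝ}
    (hY : IsStationaryGaussian (increment (discretization B)) (fgnCov H) (P H)) (n : ℕ) :
    scaledVariance P B n H = (n : ℝ)⁻¹ *
      Var[fun ω ↦ ∑ k ∈ Finset.range n, signChange (increment (discretization B)) k ω; P H] := by
  have hae : changeFrequency (discretization B) n =ᵐ[P H] fun ω ↦ 1 / (n : ℝ) *
      ∑ k ∈ Finset.range n, signChange (increment (discretization B)) k ω := by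
    have hall : ∀ᵐ ω ∂P H, ∀ k, changeIndicator (discretization B) k ω =
        signChange (increment (discretization B)) k ω :=
      ae_all_iff.2 fun k ↦ changeIndicator_ae_eq_signChange hY k
    filter_upwards [hall] with ω h
    simp only [changeFrequency, h]
  rw [scaledVariance, variance_congr hae, variance_const_mul]
  by_cases hn : (n : ℝ) = 0
  · simp [hn]
  · field_simp

lemma continuousOn_signChangeCov {Y : ℕ → Ω → ℝ}
    (hY : ∀ H ∈ Set.Ioo (0 : ℝ) (3 / 4), IsStationaryGaussian Y (fgnCov H) (P H)) (k : ℤ) :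
    ContinuousOn (fun H ↦ signChangeCov Y P H k) (Set.Ioo 0 (3 / 4)) := by
  have hr (H : Set.Ioo (0 : ℝ) (3 / 4)) : |fgnCov H 1| < 1 :=
    (abs_fgnCov_one_le H.2).trans_lt (by norm_num)
  rw [continuousOn_iff_continuous_domRestrict, continuous_iff_seqContinuous]
  intro u H hu
  refine IsStationaryGaussian.tendsto_covariance_signChange
    (Q := fun n ↦ P (u n)) (ρ := fun n ↦ fgnCov (u n)) (ρ' := fgnCov H)
    (fun n ↦ hY _ (u n).2) (fun n ↦ hr _) (hY _ H.2) (hr _) (fun j ↦ ?_) _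
  have hc : Continuous fun H : Set.Ioo (0 : ℝ) (3 / 4) ↦ fgnCov H j :=
    ((continuousOn_fgnCov j).mono Set.Ioo_subset_Ioi_self).domRestrict
  exact (hc.tendsto H).comp hu

end AsymptoticVariance

theorem lemma4 {Ω : Type*} [MeasurableSpace Ω] (P : ℝ → Measure Ω) (B : ℝ≥0 → Ω → ℝ)
    (hB_meas : ∀ t, Measurable (B t))
    (hB_fbm : ∀ H ∈ Set.Ioc (0 : ℝ) 1, IsFBM H B (P H))
    (hB_std : ∀ H ∈ Set.Ioc (0 : ℝ) 1, Var[B 1; P H] = 1) :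
    ∃ f : ℝ → ℝ,
      (∀ H ∈ Set.Ioo (0 : ℝ) (3 / 4),
        Tendsto (fun n : ℕ => scaledVariance P B n H) atTop (𝓝 (f H))) ∧
      (∀ I : Set ℝ, IsCompact I → I ⊆ Set.Ioo (0 : ℝ) (3 / 4) →
        TendstoUniformlyOn (fun n : ℕ => scaledVariance P B n) f atTop I) ∧
      ContinuousOn f (Set.Ioo (0 : ℝ) (3 / 4)) ∧
      ∀ H ∈ Set.Ioo (0 : ℝ) (3 / 4), 0 < f H := by
  let Y := increment (discretization B)
  have hY (H : ℝ) (hH : H ∈ Set.Ioo (0 : ℝ) (3 / 4)) :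
      IsStationaryGaussian Y (fgnCov H) (P H) :=
    have hH1 : H ∈ Set.Ioc (0 : ℝ) 1 := ⟨hH.1, by linarith [hH.2]⟩
    isStationaryGaussian_increment (hB_fbm H hH1) (hB_std H hH1)
  have heq (H : ℝ) (hH : H ∈ Set.Ioo (0 : ℝ) (3 / 4)) (n : ℕ) :
      scaledVariance P B n H = (n : ℝ)⁻¹ *
        ∑ j ∈ Finset.range n, ∑ l ∈ Finset.range n, signChangeCov Y P H ((l : ℤ) - j) := by
    rw [scaledVariance_eq_inv_mul_variance (hY H hH), variance_sum_signChange (hY H hH) hH]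
  have hlim (H : ℝ) (hH : H ∈ Set.Ioo (0 : ℝ) (3 / 4)) :
      Tendsto (fun n : ℕ ↦ scaledVariance P B n H) atTop (𝓝 (∑' k, signChangeCov Y P H k)) := by
    simp_rw [heq H hH]
    exact tendsto_inv_mul_sum_range_sum_range_sub <| Summable.of_norm_bounded
      (summable_signChangeBound hH.2) (abs_signChangeCov_le (hY H hH) hH le_rfl)
  refine ⟨fun H ↦ ∑' k, signChangeCov Y P H k, hlim, fun I hI hsub ↦ ?_, ?_, fun H hH ↦ ?_⟩
  · rcases I.eq_empty_or_nonempty with rfl | hne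
    · exact tendstoUniformlyOn_empty
    obtain ⟨h, hhI, hmax⟩ := hI.exists_isGreatest hne
    have hb := summable_signChangeBound (hsub hhI).2
    rw [Metric.tendstoUniformlyOn_iff]
    intro ε hε
    filter_upwards [(tendsto_inv_mul_sum_tail hb).eventually_lt_const hε, eventually_ne_atTop 0]
      with n hn hn0 H hHI
    rw [dist_comm, Real.dist_eq, heq H (hsub hHI)]
    exact (abs_inv_mul_sum_range_sum_range_sub_sub_tsum_le hb
      (abs_signChangeCov_le (hY H (hsub hHI)) (hsub hHI) (hmax hHI)) hn0).trans_lt hn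
  · intro H hH
    -- a Hurst parameter `h` with `H < h < 3 / 4`, up to which the summable bound is uniform
    obtain ⟨h, hHh, hh⟩ := exists_between hH.2
    have hmono : Set.Ioo 0 h ⊆ Set.Ioo (0 : ℝ) (3 / 4) := Set.Ioo_subset_Ioo_right hh.le
    have hcont : ContinuousOn (fun H ↦ ∑' k, signChangeCov Y P H k) (Set.Ioo 0 h) :=
      continuousOn_tsum (fun k ↦ (continuousOn_signChangeCov hY k).mono hmono)
        (summable_signChangeBound hh) fun k x hx ↦
          abs_signChangeCov_le (hY x (hmono hx)) (hmono hx) hx.2.le k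
    exact (hcont.continuousAt (Ioo_mem_nhds hH.1 hHh)).continuousWithinAt
  · refine (hY H hH).pos_of_tendsto_variance ((abs_fgnCov_one_le hH).trans_lt (by norm_num))
      (summable_fgnCov_sq hH) ?_
    exact (hlim H hH).congr fun n ↦ scaledVariance_eq_inv_mul_variance (hY H hH) n
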